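/- **Theorem (Safety of shielded environments).** *Shield specifications.* Terms of differential dynamic logic (dL) are built from real literals, variables, constant symbols, unknown function symbols of fixed arity, $|\cdot|,+,\times,\min,\max$; formulas and hybrid programs have their usual dL semantics. An interpretation $c\cup u$ gives values $c$ to the constants and $u$ to the unknowns. A *shield specification* consists of: a set of closed formulas $\mathsf{Assum}$ (read as a conjunction); state variables; for every bound parameter $p$ a direction (up/lo) and a formula $\mathsf{Bound}_p$, whose free variables are $p$ and state variables, monotone in $p$ for upper bounds and antitone for lower bounds ($p$ is *global* if no state variable is free in $\mathsf{Bound}_p$, else *local*; $\mathsf{GBound}$ and $\mathsf{Bound}$ are the conjunctions over the global, resp. all, parameters); a controller $\mathsf{Ctrl}$ (a hybrid program without loops, ODEs, modalities, quantifiers and unknowns, reading parameters and state variables and modifying state variables only); a program $\mathsf{Plant}$ that reads and modifies state variables only; formulas $\mathsf{Safe}$ over state variables and $\mathsf{Inv}$ over state variables and global parameters; for each noise variable a normal, uniform or Bernoulli distribution whose arguments are unknown-free terms over state variables, all noise variables being independent; for each observation variable $\omega$ a term $\mathsf{Obs}_\omega$ over state and noise variables; and an inference strategy, a sequence of assignments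 $p:=e$ with $e$ of the form ($\theta$ when $G$), (best $i_1,\dots,i_n:\theta$ when $G$) or (aggregate $i_1,\dots,i_n:\theta_1$ and $\theta_2$ when $G$). Here the expressions may contain variables $x_{i_k}$ indexed by a history position, $G$ is quantifier- and modality-free, $\theta_1$ contains no noise variables, $\theta_2$ contains neither observation variables nor bound parameters, and every local parameter has an unguarded assignment $p:=\theta$ with $\theta$ built from constants, state variables and global parameters. *Proof obligations.* The following are assumed valid (true under all interpretations and states): $\mathsf{Assum}\wedge\mathsf{GBound}\wedge\mathsf{Inv}\to\mathsf{Safe}$; $\mathsf{Assum}\wedge\mathsf{Bound}\wedge\mathsf{Inv}\to[\mathsf{Ctrl};\mathsf{Plant}]\mathsf{Inv}$; $\mathsf{Assum}\wedge\mathsf{Bound}\wedge\mathsf{Inv}\to\langle\mathsf{Ctrl}\rangle\mathsf{true}$; under $\mathsf{Assum}$, $\mathsf{Inv}$ is preserved when an upper-bound parameter is decreased or a lower-bound parameter is increased; and for every assignment $p:=e$, $\mathsf{Assum}\wedge\bigwedge_{y\in FV(e)}D(y)\to(G\to\mathsf{Bound}_p[\theta/p])$, with $\theta_1+\theta_2$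 for $\theta$ in the case of aggregate, where $D(y)$ is $\mathsf{Inv}$ for $y$ a state variable, $\mathsf{Bound}_y$ for $y$ a parameter and $y=\mathsf{Obs}_y$ for $y$ an observation variable, with all variables carrying the index of $y$ if $y$ is indexed. *Environment.* A *compatible environment* consists of an MDP with state space $S$, action space $A$ and Markov kernel $P$; a map $\varphi_s$ from $S$ to valuations of the state variables; a surjection $\varphi_a$ from $A$ onto the action space of $\mathsf{Ctrl}$ (an action records how all nondeterministic choices are resolved) with a right inverse $\varphi_a^{-1}$; true values $c,u$ of constants and unknowns; for each $s\in S$ a set $\alpha(s)$ of available observations; and, for each $s$, a probability law $\mu(s)$ on valuations of the observation variables, equal to the law of $(\mathsf{Obs}_\omega(c\cup u,\varphi_s(s)\cup\eta))_\omega$ for $\eta$ drawn from the noise distributions at $\varphi_s(s)$. Moreover, for all $s\in S$, $a\in A$ and parameter values $b$: if $\varphi_s(s)\cup b$ satisfies $\mathsf{Assum}\wedge\mathsf{Bound}\wedge\mathsf{Inv}$ under $c\cup u$ and the state $s''$ obtained by executing $\mathsf{Ctrl}$ from $\varphi_s(s)\cup b$ along $\varphi_a(a)$ is a result of a run of $\mathsf{Ctrl}$,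 then for $P(s,a)$-almost every $s'$ the program $\mathsf{Plant}$ can go from $s''$ to $\varphi_s(s')\cup b$. *Shielded MDP.* Its states are tuples $(s,h,b_G,\varepsilon_{\rm rem})$ of a state $s\in S$, a history $h$ (a list of triples of a state, a set of available observations and values of the local parameters), values $b_G$ of the global parameters and a remaining budget $\varepsilon_{\rm rem}\in[0,1]$; its actions are pairs of an action in $A$ and an inference action, which provides for every best-assignment a list of index tuples and for every aggregate-assignment a pair $(\varepsilon',D)$ of a budget in $[0,1]$ and a finitely supported distribution $D$ on index tuples. A transition is sampled as follows. 1. The inference action turns the strategy into a list $B$ of triples $(p,e',\varepsilon')$: $(\theta\text{ when }G,0)$ for a direct assignment; $(\theta[j/i]\text{ when }G[j/i],0)$ for each listed tuple $j$ for best; and for aggregate, with $X=\sum_{(\lambda,j)\in D}\lambda\theta_2[j/i]$, the pair $(\sum_{(\lambda,j)\in D}\lambda\theta_1[j/i]+\delta\text{ when }\bigwedge_{(\lambda,j)\in D} G[j/i],\ \varepsilon')$, where $\delta=\mathrm{InvCCDF}(X,\varepsilon')$ for an upper bound and $\delta=-\mathrm{InvCCDF}(-X,\varepsilon')$ for a lower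 bound. Here $\mathrm{InvCCDF}$ is any procedure that either fails or returns a number exceeded by its random argument with probability at most $\varepsilon'$. 2. Let $n=|h|+1$. A valuation $v$ is initialized with $\varphi_s(s)$ and $b_G$, both unindexed and with index $n$. For each history position $i$ such that some $\omega_i$ occurs in $B$, observations are freshly and independently sampled from $\mu$ at the $i$-th recorded state; the measurements of those $\omega_i$ that occur in $B$ and are marked available, the recorded state and the recorded local parameters are added to $v$ with index $i$; and position $i$ is then marked as having no available observation. 3. For each $(p,e',\varepsilon')\in B$ in order: skip it if $\varepsilon'>\varepsilon_{\rm rem}$; otherwise subtract $\varepsilon'$ from $\varepsilon_{\rm rem}$ and evaluate $e'$ with $c$ and $v$ (failing if an undefined variable or symbol is accessed or the guard is false); if this yields a value and $p$ is unset or the value is strictly tighter than $v(p)$, set $p$ and $p_n$ to it. 4. Let $b_L,b_G$ be the resulting local and global parameter values and append $(s,\alpha(s),b_L)$ to the history. If the monitor of $\mathsf{Ctrl}$ with constants $c$ and parameters $b_G\cup b_L$ (which checks that all tests pass along an action) rejects the image under $\varphi_a$ of the proposed action, replace the proposed action by $\varphi_a^{-1}$ of a fallback action; the fallback action is permitted by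 the monitor whenever some action is. The next environment state is drawn from $P$ at $s$ and the resulting action. Assume that these transitions form a Markov kernel (measurability), and that the set of $s\in S$ with $(c\cup u,\varphi_s(s))\models\mathsf{Safe}$ is measurable. *Conclusion.* Let $\varepsilon\in[0,1]$, let $b$ be an instantiation of the global parameters and let $s\in S$ be such that $(c\cup u,\varphi_s(s)\cup b)\models\mathsf{Assum}\wedge\mathsf{GBound}\wedge\mathsf{Inv}$. Then for every (randomized, history-dependent) policy, the infinite trace of the shielded MDP started in $(s,\emptyset,b,\varepsilon)$ satisfies, with probability at least $1-\varepsilon$, $(c\cup u,\varphi_s(s_t))\models\mathsf{Safe}$ for all $t\ge 0$, where $s_t$ is the environment state at time $t$. -/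

import Mathlib

open MeasureTheory ProbabilityTheory
open scoped ENNReal

noncomputable section

namespace AdaptiveShield

/-! ## Differential dynamic logic -/

/-- The names available to a shield specification. Symbols are either constants (arity zero) or
unknowns (of fixed arity). -/
structure Signature where
  Const : Type
  Unknown : Type
  arity : Unknown → ℕ
  StateVar : Type
  Param : Type
  NoiseVar : Type
  ObsVar : Type

/-- The variables of the logic. The variables `aux k` play no role in a specification other than
being available as bound variables of quantifiers. -/
inductive DLVar (Sg : Signature) : Type
  | state (x : Sg.StateVar)
  | param (p : Sg.Param)
  | obs (ω : Sg.ObsVar)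
  | noise (η : Sg.NoiseVar)
  | aux (k : ℕ)

/-- Arithmetic operators of terms. -/
inductive ArithOp : Type
  | add | mul | min | max

/-- Comparison operators between terms. -/
inductive CmpOp : Type
  | eq | lt | le | ge | gt

/-- Terms over variables in `X`. -/
inductive Term (Sg : Signature) (X : Type) : Type
  | num (r : ℝ)
  | var (x : X)
  | const (k : Sg.Const)
  | unk (f : Sg.Unknown) (args : Fin (Sg.arity f) → Term Sg X)
  | abs (θ : Term Sg X)
  | bin (op : ArithOp) (θ₁ θ₂ : Term Sg X)

mutual
/-- Hybrid programs. `ode sys Q` is the system of equations `x' = θ` for `(x, θ) ∈ sys`, with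
evolution domain `Q`. -/
inductive Program (Sg : Signature) (X : Type) : Type
  | assign (x : X) (θ : Term Sg X)
  | random (x : X)
  | test (Q : Formula Sg X)
  | ode (sys : List (X × Term Sg X)) (Q : Formula Sg X)
  | choice (α β : Program Sg X)
  | seq (α β : Program Sg X)
  | loop (α : Program Sg X)
/-- Formulas. -/
inductive Formula (Sg : Signature) (X : Type) : Type
  | cmp (op : CmpOp) (θ₁ θ₂ : Term Sg X)
  | all (x : X) (P : Formula Sg X)
  | ex (x : X) (P : Formula Sg X)
  | box (α : Program Sg X) (P : Formula Sg X)
  | diamond (α : Program Sg X) (P : Formula Sg X)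
  | not (P : Formula Sg X)
  | or (P Q : Formula Sg X)
  | and (P Q : Formula Sg X)
  | imp (P Q : Formula Sg X)
end

/-- Interpretations of the symbols (`c ∪ u`). -/
structure Interp (Sg : Signature) where
  const : Sg.Const → ℝ
  unk : (f : Sg.Unknown) → (Fin (Sg.arity f) → ℝ) → ℝ

def ArithOp.eval : ArithOp → ℝ → ℝ → ℝ
  | .add, a, b => a + b
  | .mul, a, b => a * b
  | .min, a, b => Min.min a b
  | .max, a, b => Max.max a b

def CmpOp.holds : CmpOp → ℝ → ℝ → Prop
  | .eq, a, b => a = b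
  | .lt, a, b => a < b
  | .le, a, b => a ≤ b
  | .ge, a, b => a ≥ b
  | .gt, a, b => a > b

def Term.eval {Sg : Signature} {X : Type} (I : Interp Sg) (w : X → ℝ) : Term Sg X → ℝ
  | .num r => r
  | .var x => w x
  | .const k => I.const k
  | .unk f args => I.unk f (fun i => (args i).eval I w)
  | .abs θ => |θ.eval I w|
  | .bin op θ₁ θ₂ => op.eval (θ₁.eval I w) (θ₂.eval I w)

open Classical in
mutual
/-- `α.sem I s t`: the state `t` is reachable from `s` by running `α` under `I`. -/
def Program.sem {Sg : Signature} {X : Type} (I : Interp Sg) :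
    Program Sg X → (X → ℝ) → (X → ℝ) → Prop
  | .assign x θ => fun s t => t = Function.update s x (θ.eval I s)
  | .random x => fun s t => ∃ r : ℝ, t = Function.update s x r
  | .test Q => fun s t => t = s ∧ Q.sem I s
  | .ode sys Q => fun s t => ∃ (T : ℝ) (φ : ℝ → X → ℝ), 0 ≤ T ∧ φ 0 = s ∧ φ T = t ∧
      ∀ τ ∈ Set.Icc (0 : ℝ) T,
        (∀ e ∈ sys, HasDerivWithinAt (fun ρ => φ ρ e.1) (e.2.eval I (φ τ)) (Set.Icc 0 T) τ) ∧
        (∀ y : X, (∀ e ∈ sys, e.1 ≠ y) → φ τ y = s y) ∧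
        Q.sem I (φ τ)
  | .choice α β => fun s t => α.sem I s t ∨ β.sem I s t
  | .seq α β => fun s t => ∃ m, α.sem I s m ∧ β.sem I m t
  | .loop α => fun s t => Relation.ReflTransGen (α.sem I) s t
/-- `P.sem I s`: the formula `P` is true in state `s` under `I`. -/
def Formula.sem {Sg : Signature} {X : Type} (I : Interp Sg) : Formula Sg X → (X → ℝ) → Prop
  | .cmp op θ₁ θ₂ => fun s => op.holds (θ₁.eval I s) (θ₂.eval I s)
  | .all x P => fun s => ∀ r : ℝ, P.sem I (Function.update s x r)
  | .ex x P => fun s => ∃ r : ℝ, P.sem I (Function.update s x r)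
  | .box α P => fun s => ∀ t, α.sem I s t → P.sem I t
  | .diamond α P => fun s => ∃ t, α.sem I s t ∧ P.sem I t
  | .not P => fun s => ¬ P.sem I s
  | .or P Q => fun s => P.sem I s ∨ Q.sem I s
  | .and P Q => fun s => P.sem I s ∧ Q.sem I s
  | .imp P Q => fun s => P.sem I s → Q.sem I s
end

/-- The formula `true`. -/
def Formula.tt {Sg : Signature} {X : Type} : Formula Sg X := .cmp .eq (.num 0) (.num 0)

/-- The free variables of `P` all lie in `V`: the truth value of `P` in a state only depends on the
values of the variables in `V`. -/
def Formula.FreeIn {Sg : Signature} {X : Type} (P : Formula Sg X) (V : Set X) : Prop :=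
  ∀ (I : Interp Sg) (s t : X → ℝ), (∀ x ∈ V, s x = t x) → (P.sem I s ↔ P.sem I t)

/-- The program `α` only reads and only modifies variables in `V`. -/
def Program.ActsOn {Sg : Signature} {X : Type} (α : Program Sg X) (V : Set X) : Prop :=
  (∀ (I : Interp Sg) (s t : X → ℝ), α.sem I s t → ∀ x ∉ V, t x = s x) ∧
  (∀ (I : Interp Sg) (s t s' t' : X → ℝ), (∀ x ∈ V, s x = s' x) → (∀ x ∈ V, t x = t' x) →
    (∀ x ∉ V, t' x = s' x) → α.sem I s t → α.sem I s' t')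

/-- Variables occurring in a term. -/
def Term.vars {Sg : Signature} {X : Type} : Term Sg X → Set X
  | .num _ => ∅
  | .var x => {x}
  | .const _ => ∅
  | .unk _ args => ⋃ i, (args i).vars
  | .abs θ => θ.vars
  | .bin _ θ₁ θ₂ => θ₁.vars ∪ θ₂.vars

/-- No unknown symbol occurs in the term. -/
def Term.NoUnknown {Sg : Signature} {X : Type} : Term Sg X → Prop
  | .num _ => True
  | .var _ => True
  | .const _ => True
  | .unk _ _ => False
  | .abs θ => θ.NoUnknown
  | .bin _ θ₁ θ₂ => θ₁.NoUnknown ∧ θ₂.NoUnknown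

def Term.rename {Sg : Signature} {X Y : Type} (g : X → Y) : Term Sg X → Term Sg Y
  | .num r => .num r
  | .var x => .var (g x)
  | .const k => .const k
  | .unk f args => .unk f (fun i => (args i).rename g)
  | .abs θ => .abs (θ.rename g)
  | .bin op θ₁ θ₂ => .bin op (θ₁.rename g) (θ₂.rename g)

/-- Quantifier-free and modality-free formulas, used in controllers and guards. -/
inductive QF (Sg : Signature) (X : Type) : Type
  | tt
  | cmp (op : CmpOp) (θ₁ θ₂ : Term Sg X)
  | not (P : QF Sg X)
  | or (P Q : QF Sg X)
  | and (P Q : QF Sg X)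
  | imp (P Q : QF Sg X)

def QF.toFormula {Sg : Signature} {X : Type} : QF Sg X → Formula Sg X
  | .tt => Formula.tt
  | .cmp op θ₁ θ₂ => .cmp op θ₁ θ₂
  | .not P => .not P.toFormula
  | .or P Q => .or P.toFormula Q.toFormula
  | .and P Q => .and P.toFormula Q.toFormula
  | .imp P Q => .imp P.toFormula Q.toFormula

def QF.vars {Sg : Signature} {X : Type} : QF Sg X → Set X
  | .tt => ∅
  | .cmp _ θ₁ θ₂ => θ₁.vars ∪ θ₂.vars
  | .not P => P.vars
  | .or P Q => P.vars ∪ Q.vars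
  | .and P Q => P.vars ∪ Q.vars
  | .imp P Q => P.vars ∪ Q.vars

def QF.NoUnknown {Sg : Signature} {X : Type} : QF Sg X → Prop
  | .tt => True
  | .cmp _ θ₁ θ₂ => θ₁.NoUnknown ∧ θ₂.NoUnknown
  | .not P => P.NoUnknown
  | .or P Q => P.NoUnknown ∧ Q.NoUnknown
  | .and P Q => P.NoUnknown ∧ Q.NoUnknown
  | .imp P Q => P.NoUnknown ∧ Q.NoUnknown

def QF.rename {Sg : Signature} {X Y : Type} (g : X → Y) : QF Sg X → QF Sg Y
  | .tt => .tt
  | .cmp op θ₁ θ₂ => .cmp op (θ₁.rename g) (θ₂.rename g)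
  | .not P => .not (P.rename g)
  | .or P Q => .or (P.rename g) (Q.rename g)
  | .and P Q => .and (P.rename g) (Q.rename g)
  | .imp P Q => .imp (P.rename g) (Q.rename g)

/-! ## Controllers, their action spaces and monitors -/

/-- Nondeterministic controllers: hybrid programs without loops, differential equations, modalities
and quantifiers, that only modify state variables. -/
inductive Ctrl (Sg : Signature) : Type
  | assign (x : Sg.StateVar) (θ : Term Sg (DLVar Sg))
  | random (x : Sg.StateVar)
  | test (Q : QF Sg (DLVar Sg))
  | choice (α β : Ctrl Sg)
  | seq (α β : Ctrl Sg)

def Ctrl.toProgram {Sg : Signature} : Ctrl Sg → Program Sg (DLVar Sg)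
  | .assign x θ => .assign (.state x) θ
  | .random x => .random (.state x)
  | .test Q => .test Q.toFormula
  | .choice α β => .choice α.toProgram β.toProgram
  | .seq α β => .seq α.toProgram β.toProgram

/-- State variables and parameters. -/
def stateOrParam (Sg : Signature) : Set (DLVar Sg) :=
  Set.range DLVar.state ∪ Set.range DLVar.param

/-- The controller mentions constants, parameters and state variables only. -/
def Ctrl.WellFormed {Sg : Signature} : Ctrl Sg → Prop
  | .assign _ θ => θ.NoUnknown ∧ θ.vars ⊆ stateOrParam Sg
  | .random _ => True
  | .test Q => Q.NoUnknown ∧ Q.vars ⊆ stateOrParam Sg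
  | .choice α β => α.WellFormed ∧ β.WellFormed
  | .seq α β => α.WellFormed ∧ β.WellFormed

/-- The action space of a controller: an action resolves all nondeterministic choices. -/
def Ctrl.Act {Sg : Signature} : Ctrl Sg → Type
  | .assign _ _ => Unit
  | .random _ => ℝ
  | .test _ => Unit
  | .choice α β => α.Act ⊕ β.Act
  | .seq α β => α.Act × β.Act

open Classical in
/-- The state resulting from the run of a controller encoded by an action. -/
def Ctrl.exec {Sg : Signature} (I : Interp Sg) :
    (α : Ctrl Sg) → (DLVar Sg → ℝ) → α.Act → (DLVar Sg → ℝ)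
  | .assign x θ, w, _ => Function.update w (.state x) (θ.eval I w)
  | .random x, w, (r : ℝ) => Function.update w (.state x) r
  | .test _, w, _ => w
  | .choice α _, w, .inl a => α.exec I w a
  | .choice _ β, w, .inr a => β.exec I w a
  | .seq α β, w, (a₁, a₂) => β.exec I (α.exec I w a₁) a₂

/-- The controller monitor: does the run encoded by the action pass all tests? -/
def Ctrl.monitor {Sg : Signature} (I : Interp Sg) :
    (α : Ctrl Sg) → (DLVar Sg → ℝ) → α.Act → Prop
  | .assign _ _, _, _ => True
  | .random _, _, _ => True
  | .test Q, w, _ => Q.toFormula.sem I w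
  | .choice α _, w, .inl a => α.monitor I w a
  | .choice _ β, w, .inr a => β.monitor I w a
  | .seq α β, w, (a₁, a₂) => α.monitor I w a₁ ∧ β.monitor I (α.exec I w a₁) a₂

/-! ## Noise distributions -/

/-- Distribution expressions: normal (mean, variance), uniform on an interval, Bernoulli. -/
inductive Dist (Sg : Signature) : Type
  | normal (θ₁ θ₂ : Term Sg (DLVar Sg))
  | uniform (θ₁ θ₂ : Term Sg (DLVar Sg))
  | bernoulli (θ : Term Sg (DLVar Sg))

def Dist.vars {Sg : Signature} : Dist Sg → Set (DLVar Sg)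
  | .normal θ₁ θ₂ => θ₁.vars ∪ θ₂.vars
  | .uniform θ₁ θ₂ => θ₁.vars ∪ θ₂.vars
  | .bernoulli θ => θ.vars

def Dist.NoUnknown {Sg : Signature} : Dist Sg → Prop
  | .normal θ₁ θ₂ => θ₁.NoUnknown ∧ θ₂.NoUnknown
  | .uniform θ₁ θ₂ => θ₁.NoUnknown ∧ θ₂.NoUnknown
  | .bernoulli θ => θ.NoUnknown

/-- Denotation of a distribution expression. Out-of-range arguments are given a meaning so that the
result is always a probability measure: a negative variance is read as `0`, a uniform distribution
on `[a, b]` with `b ≤ a` is the point mass at `a`, and success probabilities are clamped to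
`[0, 1]`. -/
def Dist.law {Sg : Signature} (I : Interp Sg) (w : DLVar Sg → ℝ) : Dist Sg → Measure ℝ
  | .normal θ₁ θ₂ => gaussianReal (θ₁.eval I w) (θ₂.eval I w).toNNReal
  | .uniform θ₁ θ₂ =>
      if θ₁.eval I w < θ₂.eval I w then
        ProbabilityTheory.cond volume (Set.Icc (θ₁.eval I w) (θ₂.eval I w))
      else Measure.dirac (θ₁.eval I w)
  | .bernoulli θ => bernoulliMeasure (1 : ℝ) 0 (Set.projIcc (0 : ℝ) 1 zero_le_one (θ.eval I w))

/-! ## The inference strategy language -/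

/-- Variables of inference expressions: unindexed variables `x`, or variables `x_i` tagged with one
of `n` symbolic indices. -/
abbrev IVar (Sg : Signature) (n : ℕ) : Type := DLVar Sg × Option (Fin n)

/-- Variables of symbolic bound instantiations: unindexed variables `x`, or variables `x_i` tagged
with a natural number (the position of a history element). -/
abbrev SVar (Sg : Signature) : Type := DLVar Sg × Option ℕ

/-- Right-hand sides of inference assignments: `θ when G`, `best i₁, …, iₙ : θ when G` and
`aggregate i₁, …, iₙ : θ₁ and θ₂ when G`. -/
inductive IExpr (Sg : Signature) : Type
  | direct (θ : Term Sg (IVar Sg 0)) (G : QF Sg (IVar Sg 0))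
  | best (n : ℕ) (θ : Term Sg (IVar Sg n)) (G : QF Sg (IVar Sg n))
  | aggregate (n : ℕ) (θ₁ θ₂ : Term Sg (IVar Sg n)) (G : QF Sg (IVar Sg n))

/-- Inference strategies: sequences of assignments `p := e`. -/
abbrev Strategy (Sg : Signature) : Type := List (Sg.Param × IExpr Sg)

/-- Finitely supported distributions, as lists of positive weights with total weight one. -/
def FDistr (J : Type) : Type :=
  {D : List (ℝ × J) // (∀ d ∈ D, 0 < d.1) ∧ (D.map Prod.fst).sum = 1}

def IExpr.Act {Sg : Signature} : IExpr Sg → Type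
  | .direct _ _ => Unit
  | .best n _ _ => List (Fin n → ℕ)
  | .aggregate n _ _ _ => unitInterval × FDistr (Fin n → ℕ)

/-- The inference action space of a strategy. -/
abbrev Strategy.Act {Sg : Signature} (ι : Strategy Sg) : Type :=
  (k : Fin ι.length) → (ι.get k).2.Act

/-- Symbolic bound instantiations. `invCCDF θ ε` binds every noise variable occurring in `θ`, a noise
variable with index `i` being distributed as prescribed by the specification in the state with index
`i`. Negation serves to treat lower bounds as negated upper bounds. -/
inductive SBInst (Sg : Signature) : Type
  | term (θ : Term Sg (SVar Sg))
  | add (e₁ e₂ : SBInst Sg)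
  | neg (e : SBInst Sg)
  | guard (e : SBInst Sg) (P : QF Sg (SVar Sg))
  | invCCDF (θ : Term Sg (SVar Sg)) (ε : unitInterval)

def SBInst.vars {Sg : Signature} : SBInst Sg → Set (SVar Sg)
  | .term θ => θ.vars
  | .add e₁ e₂ => e₁.vars ∪ e₂.vars
  | .neg e => e.vars
  | .guard e P => e.vars ∪ P.vars
  | .invCCDF θ _ => θ.vars

/-- Direction of a bound: upper or lower. -/
inductive Dir : Type
  | up | lo

/-- `Dir.tighter d r r'`: as a bound of direction `d`, `r` is strictly tighter than `r'`. -/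
def Dir.tighter : Dir → ℝ → ℝ → Prop
  | .up, r, r' => r < r'
  | .lo, r, r' => r' < r

/-- Instantiation of the symbolic indices by history positions. -/
def inst {Sg : Signature} {n : ℕ} (j : Fin n → ℕ) : IVar Sg n → SVar Sg :=
  fun x => (x.1, x.2.map j)

/-- The term `∑_{(λ, j) ∈ D} λ · θ[j/i]`. -/
def weightedSum {Sg : Signature} {n : ℕ} (D : List (ℝ × (Fin n → ℕ))) (θ : Term Sg (IVar Sg n)) :
    Term Sg (SVar Sg) :=
  D.foldr (fun d acc => .bin .add (.bin .mul (.num d.1) (θ.rename (inst d.2))) acc) (.num 0)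

/-- The formula `⋀_{(λ, j) ∈ D} G[j/i]`. -/
def conjGuard {Sg : Signature} {n : ℕ} (D : List (ℝ × (Fin n → ℕ))) (G : QF Sg (IVar Sg n)) :
    QF Sg (SVar Sg) :=
  D.foldr (fun d acc => .and (G.rename (inst d.2)) acc) .tt

/-- The tail component of an aggregate of noise term `θ` (already averaged) with tolerance `ε`: an
upper tail bound for `θ` for an upper bound, and minus an upper tail bound for `-θ` for a lower
bound. -/
def tailInst {Sg : Signature} (ε : unitInterval) (θ : Term Sg (SVar Sg)) : Dir → SBInst Sg
  | .up => .invCCDF θ ε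
  | .lo => .neg (.invCCDF (.bin .mul (.num (-1)) θ) ε)

/-- The symbolic bound instantiations and failure probabilities denoted by an inference expression
and an action. -/
def IExpr.sem {Sg : Signature} (d : Dir) : (e : IExpr Sg) → e.Act → List (SBInst Sg × unitInterval)
  | .direct θ G, _ =>
      [(.guard (.term (θ.rename (inst Fin.elim0))) (G.rename (inst Fin.elim0)), 0)]
  | .best _ θ G, J =>
      List.map (fun j => (.guard (.term (θ.rename (inst j))) (G.rename (inst j)), 0)) J
  | .aggregate _ θ₁ θ₂ G, (ε, D) =>
      [(.guard (.add (.term (weightedSum D.1 θ₁)) (tailInst ε (weightedSum D.1 θ₂) d))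
          (conjGuard D.1 G), ε)]

/-- The list of symbolic inference assignments denoted by a strategy and an action. -/
def Strategy.sem {Sg : Signature} (dir : Sg.Param → Dir) (ι : Strategy Sg) (a : ι.Act) :
    List (Sg.Param × SBInst Sg × unitInterval) :=
  (List.finRange ι.length).flatMap fun k =>
    ((ι.get k).2.sem (dir (ι.get k).1) (a k)).map fun e => ((ι.get k).1, e.1, e.2)

/-! ## Shield specifications -/

structure ShieldSpec (Sg : Signature) where
  assum : Set (Formula Sg (DLVar Sg))
  dir : Sg.Param → Dir
  bound : Sg.Param → Formula Sg (DLVar Sg)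
  ctrl : Ctrl Sg
  plant : Program Sg (DLVar Sg)
  safe : Formula Sg (DLVar Sg)
  inv : Formula Sg (DLVar Sg)
  noise : Sg.NoiseVar → Dist Sg
  obs : Sg.ObsVar → Term Sg (DLVar Sg)
  infer : Strategy Sg

section Spec

variable {Sg : Signature} (spec : ShieldSpec Sg)

/-- A parameter is global if no state variable is free in its bound, and local otherwise. -/
def ShieldSpec.IsGlobal (p : Sg.Param) : Prop := (spec.bound p).FreeIn {DLVar.param p}

abbrev ShieldSpec.GParam : Type := {p : Sg.Param // spec.IsGlobal p}

abbrev ShieldSpec.LParam : Type := {p : Sg.Param // ¬ spec.IsGlobal p}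

/-- Truth of the conjunction of all assumptions. -/
def ShieldSpec.Assum (I : Interp Sg) (w : DLVar Sg → ℝ) : Prop := ∀ P ∈ spec.assum, P.sem I w

/-- Truth of the conjunction of all bounds. -/
def ShieldSpec.Bound (I : Interp Sg) (w : DLVar Sg → ℝ) : Prop := ∀ p, (spec.bound p).sem I w

/-- Truth of the conjunction of all global bounds. -/
def ShieldSpec.GBound (I : Interp Sg) (w : DLVar Sg → ℝ) : Prop :=
  ∀ p, spec.IsGlobal p → (spec.bound p).sem I w

/-- Syntactic requirement on inference expressions: in an aggregate, the observable component
contains no noise variable, and the noise component contains neither observation variables nor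
bound parameters. -/
def IExpr.WellFormed : IExpr Sg → Prop
  | .direct _ _ => True
  | .best _ _ _ => True
  | .aggregate _ θ₁ θ₂ _ =>
      (∀ η i, (DLVar.noise η, i) ∉ θ₁.vars) ∧
      (∀ ω i, (DLVar.obs ω, i) ∉ θ₂.vars) ∧ (∀ p i, (DLVar.param p, i) ∉ θ₂.vars)

/-- Every local parameter is given a default value by some unguarded direct assignment, built from
constants, state variables and global parameters. -/
def ShieldSpec.HasDefaults : Prop :=
  ∀ p, ¬ spec.IsGlobal p → ∃ θ : Term Sg (IVar Sg 0), (p, IExpr.direct θ .tt) ∈ spec.infer ∧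
    θ.NoUnknown ∧ ∀ x ∈ θ.vars, (∃ y, x.1 = DLVar.state y) ∨ ∃ q, spec.IsGlobal q ∧ x.1 = .param q

open Classical in
/-- The requirements on the components of a shield specification. -/
structure ShieldSpec.WellFormed : Prop where
  assum_closed : ∀ P ∈ spec.assum, P.FreeIn ∅
  bound_free : ∀ p, (spec.bound p).FreeIn (Set.range DLVar.state ∪ {DLVar.param p})
  bound_mono : ∀ p, spec.dir p = .up → ∀ (I : Interp Sg) (w : DLVar Sg → ℝ) (x y : ℝ), x ≤ y →
    (spec.bound p).sem I (Function.update w (.param p) x) →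
    (spec.bound p).sem I (Function.update w (.param p) y)
  bound_anti : ∀ p, spec.dir p = .lo → ∀ (I : Interp Sg) (w : DLVar Sg → ℝ) (x y : ℝ), x ≤ y →
    (spec.bound p).sem I (Function.update w (.param p) y) →
    (spec.bound p).sem I (Function.update w (.param p) x)
  ctrl_wf : spec.ctrl.WellFormed
  plant_acts : spec.plant.ActsOn (Set.range DLVar.state)
  safe_free : spec.safe.FreeIn (Set.range DLVar.state)
  inv_free : spec.inv.FreeIn (Set.range DLVar.state ∪ DLVar.param '' {p | spec.IsGlobal p})
  noise_wf : ∀ η, (spec.noise η).NoUnknown ∧ (spec.noise η).vars ⊆ Set.range DLVar.state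
  obs_wf : ∀ ω, (spec.obs ω).vars ⊆ Set.range DLVar.state ∪ Set.range DLVar.noise
  infer_wf : ∀ a ∈ spec.infer, a.2.WellFormed
  infer_defaults : spec.HasDefaults

/-- The defining assumption attached to a (possibly indexed) variable of an inference expression:
the invariant for a state variable, the bound for a parameter, the defining equation for an
observation variable, each read in the variables with the same index. -/
def ShieldSpec.varDef {n : ℕ} (I : Interp Sg) (w : IVar Sg n → ℝ) : IVar Sg n → Prop
  | (.state _, i) => spec.inv.sem I (fun y => w (y, i))
  | (.param p, i) => (spec.bound p).sem I (fun y => w (y, i))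
  | (.obs ω, i) => w (.obs ω, i) = (spec.obs ω).eval I (fun y => w (y, i))
  | (.noise _, _) => True
  | (.aux _, _) => True

open Classical in
/-- Validity of `Assum ∧ ⋀ VarDef(V) → G → Bound_p(θ)`. -/
def ShieldSpec.obligation {n : ℕ} (p : Sg.Param) (V : Set (IVar Sg n)) (G : QF Sg (IVar Sg n))
    (θ : Term Sg (IVar Sg n)) : Prop :=
  ∀ (I : Interp Sg) (w : IVar Sg n → ℝ), spec.Assum I (fun y => w (y, none)) →
    (∀ x ∈ V, spec.varDef I w x) → G.toFormula.sem I w →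
    (spec.bound p).sem I (Function.update (fun y => w (y, none)) (.param p) (θ.eval I w))

/-- The proof obligation generated by an inference assignment. -/
def ShieldSpec.inferObligation (p : Sg.Param) : IExpr Sg → Prop
  | .direct θ G => spec.obligation p (θ.vars ∪ G.vars) G θ
  | .best _ θ G => spec.obligation p (θ.vars ∪ G.vars) G θ
  | .aggregate _ θ₁ θ₂ G =>
      spec.obligation p (θ₁.vars ∪ θ₂.vars ∪ G.vars) G (.bin .add θ₁ θ₂)

open Classical in
/-- Validity of all generated proof obligations. -/
structure ShieldSpec.Obligations : Prop where
  inv_safe : ∀ (I : Interp Sg) (w : DLVar Sg → ℝ),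
    spec.Assum I w → spec.GBound I w → spec.inv.sem I w → spec.safe.sem I w
  inv_preserved : ∀ (I : Interp Sg) (w : DLVar Sg → ℝ),
    spec.Assum I w → spec.Bound I w → spec.inv.sem I w →
    (Formula.box (.seq spec.ctrl.toProgram spec.plant) spec.inv).sem I w
  ctrl_total : ∀ (I : Interp Sg) (w : DLVar Sg → ℝ),
    spec.Assum I w → spec.Bound I w → spec.inv.sem I w →
    (Formula.diamond spec.ctrl.toProgram .tt).sem I w
  inv_monotone : ∀ (I : Interp Sg) (w : DLVar Sg → ℝ) (p : Sg.Param) (r r' : ℝ),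
    spec.Assum I w → (spec.dir p).tighter r r' →
    spec.inv.sem I (Function.update w (.param p) r') →
    spec.inv.sem I (Function.update w (.param p) r)
  infer_sound : ∀ a ∈ spec.infer, spec.inferObligation a.1 a.2

end Spec

/-! ## Evaluation of symbolic bound instantiations -/

/-- Partial valuations of the variables of symbolic bound instantiations. -/
abbrev PVal (Sg : Signature) : Type := SVar Sg → Option ℝ

/-- The interpretation available at runtime: the value of unknowns is irrelevant, since it is only
used for expressions without unknowns. -/
def constInterp {Sg : Signature} (c : Sg.Const → ℝ) : Interp Sg := ⟨c, fun _ _ => 0⟩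

/-- Totalization of a partial valuation; undefined variables are never accessed. -/
def PVal.total {Sg : Signature} (v : PVal Sg) : SVar Sg → ℝ := fun x => (v x).getD 0

/-- All variables of `V` have a value. -/
def PVal.DefinedOn {Sg : Signature} (v : PVal Sg) (V : Set (SVar Sg)) : Prop :=
  ∀ x ∈ V, (v x).isSome

section Runtime

variable {Sg : Signature} (spec : ShieldSpec Sg)

/-- The law of the (mutually independent) noise variables in a state. -/
def ShieldSpec.noiseLaw (c : Sg.Const → ℝ) (w : DLVar Sg → ℝ) : Measure (Sg.NoiseVar → ℝ) :=
  Measure.infinitePi fun η => (spec.noise η).law (constInterp c) w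

/-- The joint law of all indexed noise variables, given a valuation. They are independent, and those
with index `i` are distributed as in the state with index `i`. -/
def ShieldSpec.indexedNoiseLaw (c : Sg.Const → ℝ) (v : PVal Sg) :
    Measure (Option ℕ → Sg.NoiseVar → ℝ) :=
  Measure.infinitePi fun i => spec.noiseLaw c (fun y => v.total (y, i))

/-- `v ∪ η`. -/
def withNoise (v : PVal Sg) (η : Option ℕ → Sg.NoiseVar → ℝ) : SVar Sg → ℝ
  | (.noise y, i) => η i y
  | x => v.total x

/-- The random expression `θ` can be evaluated: it has no unknown symbols, all its variables other
than noise variables have a value, and so do those on which the laws of its noise variables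
depend. -/
def ShieldSpec.TailDefined (v : PVal Sg) (θ : Term Sg (SVar Sg)) : Prop :=
  θ.NoUnknown ∧ ∀ x ∈ θ.vars,
    match x with
    | (.noise η, i) => ∀ y ∈ (spec.noise η).vars, (v (y, i)).isSome
    | x => (v x).isSome

/-- An implementation of the inverse tail function: it receives the constants, a valuation, a random
expression and a tolerance, and may fail. -/
abbrev TailFun (Sg : Signature) : Type :=
  (Sg.Const → ℝ) → PVal Sg → Term Sg (SVar Sg) → unitInterval → Option ℝ

/-- The contract of an inverse tail function: a returned value is exceeded with probability at most
the tolerance. -/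
def ShieldSpec.IsInvCCDF (tail : TailFun Sg) : Prop :=
  ∀ (c : Sg.Const → ℝ) (v : PVal Sg) (θ : Term Sg (SVar Sg)) (ε : unitInterval) (b : ℝ),
    spec.TailDefined v θ → tail c v θ ε = some b →
    spec.indexedNoiseLaw c v {η | b < θ.eval (constInterp c) (withNoise v η)}
      ≤ ENNReal.ofReal (ε : ℝ)

open Classical in
/-- Evaluation of a symbolic bound instantiation, `none` being failure. -/
def ShieldSpec.evalInst (tail : TailFun Sg) (c : Sg.Const → ℝ) (v : PVal Sg) :
    SBInst Sg → Option ℝ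
  | .term θ =>
      if θ.NoUnknown ∧ v.DefinedOn θ.vars then some (θ.eval (constInterp c) v.total) else none
  | .add e₁ e₂ =>
      (ShieldSpec.evalInst tail c v e₁).bind fun r₁ =>
        (ShieldSpec.evalInst tail c v e₂).map fun r₂ => r₁ + r₂
  | .neg e => (ShieldSpec.evalInst tail c v e).map fun r => -r
  | .guard e P =>
      if P.NoUnknown ∧ v.DefinedOn P.vars ∧ P.toFormula.sem (constInterp c) v.total then
        ShieldSpec.evalInst tail c v e
      else none
  | .invCCDF θ ε => if spec.TailDefined v θ then tail c v θ ε else none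

end Runtime

/-! ## Markov decision processes and their traces -/

/-- Markov decision processes. -/
structure MDP (S A : Type*) [MeasurableSpace S] [MeasurableSpace A] where
  P : Kernel (S × A) S
  markov : IsMarkovKernel P
  R : S → A → S → ℝ
  γ : ℝ
  γ_mem : γ ∈ Set.Ioo (0 : ℝ) 1

attribute [instance] MDP.markov

/-- Randomized history-dependent policies: `first` chooses the initial action and `next n` the action
of time `n + 1`, given all states and actions up to time `n` and the state at time `n + 1`. -/
structure Policy (S A : Type*) [MeasurableSpace S] [MeasurableSpace A] where
  first : Kernel S A
  next : (n : ℕ) → Kernel ((Finset.Iic n → S × A) × S) A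
  first_markov : IsMarkovKernel first
  next_markov : ∀ n, IsMarkovKernel (next n)

attribute [instance] Policy.first_markov Policy.next_markov

section Trace

variable {S A : Type*} [MeasurableSpace S] [MeasurableSpace A]

/-- The law of the state and action at time `n + 1`, given those up to time `n`. -/
def MDP.stepKernel (M : MDP S A) (π : Policy S A) (n : ℕ) :
    Kernel (Finset.Iic n → S × A) (S × A) :=
  (M.P.comap (fun x => x ⟨n, Finset.mem_Iic.2 le_rfl⟩) (measurable_pi_apply _)) ⊗ₖ π.next n

instance (M : MDP S A) (π : Policy S A) (n : ℕ) : IsMarkovKernel (M.stepKernel π n) := by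
  unfold MDP.stepKernel; infer_instance

/-- The law of the trace of states and actions from the initial state `s₀` under the policy `π`. -/
def MDP.traceLaw (M : MDP S A) (π : Policy S A) (s₀ : S) : Measure (ℕ → S × A) :=
  Kernel.trajMeasure (X := fun _ => S × A) (Measure.dirac s₀ ⊗ₘ π.first) (M.stepKernel π)

end Trace

/-! ## Compatible environments -/

/-- The valuation `s ∪ b`; the other variables, which are irrelevant, get the value `0`. -/
def join {Sg : Signature} (s : Sg.StateVar → ℝ) (b : Sg.Param → ℝ) : DLVar Sg → ℝ
  | .state x => s x
  | .param p => b p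
  | _ => 0

/-- The valuation `s ∪ η` of state and noise variables. -/
def joinNoise {Sg : Signature} (s : Sg.StateVar → ℝ) (η : Sg.NoiseVar → ℝ) : DLVar Sg → ℝ
  | .state x => s x
  | .noise y => η y
  | _ => 0

/-- Compatible environments. In `model_correct`, the support condition on the next state is read as
"for almost every next state", and the third premise says that the state obtained by executing the
action is a result of the controller. -/
structure CompatibleEnv {Sg : Signature} (spec : ShieldSpec Sg) (S A : Type*)
    [MeasurableSpace S] [MeasurableSpace A] where
  mdp : MDP S A
  φs : S → Sg.StateVar → ℝ
  φa : A → spec.ctrl.Act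
  φaInv : spec.ctrl.Act → A
  c : Sg.Const → ℝ
  u : (f : Sg.Unknown) → (Fin (Sg.arity f) → ℝ) → ℝ
  α : S → Set Sg.ObsVar
  μ : S → Measure (Sg.ObsVar → ℝ)
  φa_surj : Function.Surjective φa
  φa_inv : ∀ a, φa (φaInv a) = a
  μ_prob : ∀ s, IsProbabilityMeasure (μ s)
  model_correct : ∀ (s : S) (a : A) (b : Sg.Param → ℝ),
    spec.Assum ⟨c, u⟩ (join (φs s) b) → spec.Bound ⟨c, u⟩ (join (φs s) b) →
    spec.inv.sem ⟨c, u⟩ (join (φs s) b) →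
    spec.ctrl.toProgram.sem ⟨c, u⟩ (join (φs s) b)
      (spec.ctrl.exec (constInterp c) (join (φs s) b) (φa a)) →
    ∀ᵐ s' ∂(mdp.P (s, a)), spec.plant.sem ⟨c, u⟩
      (spec.ctrl.exec (constInterp c) (join (φs s) b) (φa a)) (join (φs s') b)
  obs_correct : ∀ s : S,
    (spec.noiseLaw c (join (φs s) 0)).map
      (fun η ω => (spec.obs ω).eval ⟨c, u⟩ (joinNoise (φs s) η)) = μ s

/-! ## Shielded environments -/

/-- The measurable structure on lists: the disjoint union over all lengths of the product spaces. -/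
instance instMeasurableSpaceList {α : Type*} [MeasurableSpace α] : MeasurableSpace (List α) :=
  MeasurableSpace.comap (fun l => (⟨l.length, l.get⟩ : Σ n : ℕ, Fin n → α)) inferInstance

instance {J : Type} [MeasurableSpace J] : MeasurableSpace (FDistr J) :=
  inferInstanceAs (MeasurableSpace {D : List (ℝ × J) //
    (∀ d ∈ D, 0 < d.1) ∧ (D.map Prod.fst).sum = 1})

instance {Sg : Signature} : (e : IExpr Sg) → MeasurableSpace e.Act
  | .direct _ _ => inferInstanceAs (MeasurableSpace Unit)
  | .best n _ _ => inferInstanceAs (MeasurableSpace (List (Fin n → ℕ)))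
  | .aggregate n _ _ _ => inferInstanceAs (MeasurableSpace (unitInterval × FDistr (Fin n → ℕ)))

section Shielded

variable {Sg : Signature} (spec : ShieldSpec Sg)

/-- Histories: lists of triples of a state, an observation availability set and an instantiation of
the local parameters. The element at list position `k` has index `k + 1`. -/
abbrev Hist (S : Type*) : Type _ := List (S × Set Sg.ObsVar × (spec.LParam → ℝ))

/-- States of the shielded environment: a state, a history, an instantiation of the global
parameters and the remaining safety budget. -/
abbrev ShState (S : Type*) : Type _ := S × Hist spec S × (spec.GParam → ℝ) × unitInterval

/-- Actions of the shielded environment: a control action and an inference action. -/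
abbrev ShAction (A : Type*) : Type _ := A × spec.infer.Act

open Classical in
/-- The instantiation `b_G ∪ b_L` of all parameters. -/
def ShieldSpec.joinParams (bG : spec.GParam → ℝ) (bL : spec.LParam → ℝ) : Sg.Param → ℝ :=
  fun p => if h : spec.IsGlobal p then bG ⟨p, h⟩ else bL ⟨p, h⟩

/-- A fallback policy for the controller instantiated with constants `c` and any parameter
instantiation `b`: whenever some action is permitted by the monitor, the fallback action is. -/
def ShieldSpec.IsFallback (c : Sg.Const → ℝ)
    (fallback : (Sg.Param → ℝ) → (Sg.StateVar → ℝ) → spec.ctrl.Act) : Prop :=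
  ∀ b s, (∃ a, spec.ctrl.monitor (constInterp c) (join s b) a) →
    spec.ctrl.monitor (constInterp c) (join s b) (fallback b s)

variable {S A : Type*} [MeasurableSpace S] [MeasurableSpace A]

/-- The set `Ω` of the indexed observation variables mentioned in a list of assignments. -/
def mentionedObs (B : List (Sg.Param × SBInst Sg × unitInterval)) : Set (Sg.ObsVar × ℕ) :=
  {x | ∃ a ∈ B, (DLVar.obs x.1, some x.2) ∈ a.2.1.vars}

open Classical in
/-- The valuation of the current state and of the global parameters. -/
def currentVal (φs : S → Sg.StateVar → ℝ) (s : S) (bG : spec.GParam → ℝ) : DLVar Sg → Option ℝ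
  | .state x => some (φs s x)
  | .param p => if hp : spec.IsGlobal p then some (bG ⟨p, hp⟩) else none
  | _ => none

open Classical in
/-- The valuation contributed by the history element of index `i`: its state, its local parameters,
and those mentioned measurements `o` that were available. -/
def historyVal (φs : S → Sg.StateVar → ℝ) (Ω : Set (Sg.ObsVar × ℕ)) (i : ℕ)
    (e : S × Set Sg.ObsVar × (spec.LParam → ℝ)) (o : Sg.ObsVar → ℝ) : DLVar Sg → Option ℝ
  | .state x => some (φs e.1 x)
  | .param p => if hp : ¬ spec.IsGlobal p then some (e.2.2 ⟨p, hp⟩) else none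
  | .obs ω => if (ω, i) ∈ Ω ∧ ω ∈ e.2.1 then some (o ω) else none
  | _ => none

open Classical in
/-- The valuation `v` before the inference assignments are executed. The current state has index
`|h| + 1`; elements of the history are loaded if some observation with their index is mentioned. -/
def loadVal (φs : S → Sg.StateVar → ℝ) (s : S) (h : Hist spec S) (bG : spec.GParam → ℝ)
    (Ω : Set (Sg.ObsVar × ℕ)) (o : Fin h.length → Sg.ObsVar → ℝ) : PVal Sg
  | (x, none) => currentVal spec φs s bG x
  | (x, some i) =>
      if i = h.length + 1 then currentVal spec φs s bG x
      else if hi : (1 ≤ i ∧ i ≤ h.length) ∧ ∃ ω, (ω, i) ∈ Ω then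
        historyVal spec φs Ω i (h.get ⟨i - 1, by omega⟩) (o ⟨i - 1, by omega⟩) x
      else none

open Classical in
/-- Removal from the history of the observations at the indices that were used. -/
def clearHist (h : Hist spec S) (Ω : Set (Sg.ObsVar × ℕ)) : Hist spec S :=
  h.mapIdx fun k e => if ∃ ω, (ω, k + 1) ∈ Ω then (e.1, ∅, e.2.2) else e

open Classical in
/-- Execution of one symbolic inference assignment, on a valuation and a remaining budget. Here `n`
is the index of the current state. -/
def stepAssign (tail : TailFun Sg) (c : Sg.Const → ℝ) (n : ℕ) (σ : PVal Sg × unitInterval)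
    (a : Sg.Param × SBInst Sg × unitInterval) : PVal Sg × unitInterval :=
  if hε : a.2.2 ≤ σ.2 then
    let rem : unitInterval :=
      ⟨(σ.2 : ℝ) - (a.2.2 : ℝ), sub_nonneg.2 hε,
        (sub_le_self _ a.2.2.2.1).trans σ.2.2.2⟩
    match spec.evalInst tail c σ.1 a.2.1 with
    | none => (σ.1, rem)
    | some r =>
        if ∀ r' ∈ σ.1 (.param a.1, none), (spec.dir a.1).tighter r r' then
          (Function.update (Function.update σ.1 (.param a.1, none) (some r))
            (.param a.1, some n) (some r), rem)
        else (σ.1, rem)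
  else σ

variable {spec}

/-- The valuation and remaining budget after the inference phase, given the measurements `o`. -/
def CompatibleEnv.inferResult (env : CompatibleEnv spec S A) (tail : TailFun Sg)
    (x : ShState spec S) (a : spec.infer.Act) (o : Fin x.2.1.length → Sg.ObsVar → ℝ) :
    PVal Sg × unitInterval :=
  (spec.infer.sem spec.dir a).foldl (stepAssign spec tail env.c (x.2.1.length + 1))
    (loadVal spec env.φs x.1 x.2.1 x.2.2.1 (mentionedObs (spec.infer.sem spec.dir a)) o, x.2.2.2)

open Classical in
/-- The control action that is eventually performed: the proposed one if the instantiated monitor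
accepts it, and otherwise the fallback action. -/
def CompatibleEnv.filterAction (env : CompatibleEnv spec S A)
    (fallback : (Sg.Param → ℝ) → (Sg.StateVar → ℝ) → spec.ctrl.Act) (s : S) (a : A)
    (b : Sg.Param → ℝ) : A :=
  if spec.ctrl.monitor (constInterp env.c) (join (env.φs s) b) (env.φa a) then a
  else env.φaInv (fallback b (env.φs s))

/-- The law of the next state of the shielded environment: measure the observations (independently
for the elements of the history), run the inference assignments, filter the control action, and
perform it in the underlying environment. -/
def CompatibleEnv.shieldedTransition (env : CompatibleEnv spec S A) (tail : TailFun Sg)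
    (fallback : (Sg.Param → ℝ) → (Sg.StateVar → ℝ) → spec.ctrl.Act)
    (x : ShState spec S) (a : ShAction spec A) : Measure (ShState spec S) :=
  (Measure.pi fun k : Fin x.2.1.length => env.μ (x.2.1.get k).1).bind fun o =>
    let r := env.inferResult tail x a.2 o
    let bL : spec.LParam → ℝ := fun p => r.1.total (.param p.1, none)
    let bG : spec.GParam → ℝ := fun p => r.1.total (.param p.1, none)
    let h : Hist spec S :=
      clearHist spec x.2.1 (mentionedObs (spec.infer.sem spec.dir a.2)) ++ [(x.1, env.α x.1, bL)]
    (env.mdp.P (x.1, env.filterAction fallback x.1 a.1 (spec.joinParams bG bL))).map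
      fun s' => (s', h, bG, r.2)

/-- `M` is the shielded environment induced by a specification and a compatible environment. -/
structure CompatibleEnv.IsShieldedMDP (env : CompatibleEnv spec S A) (tail : TailFun Sg)
    (fallback : (Sg.Param → ℝ) → (Sg.StateVar → ℝ) → spec.ctrl.Act)
    (M : MDP (ShState spec S) (ShAction spec A)) : Prop where
  P_eq : ∀ x a, M.P (x, a) = env.shieldedTransition tail fallback x a
  R_eq : ∀ x a x', M.R x a x' = env.mdp.R x.1 a.1 x'.1
  γ_eq : M.γ = env.mdp.γ

/-- The environment state `s` satisfies the safety constraint. -/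
def CompatibleEnv.SafeState (env : CompatibleEnv spec S A) (s : S) : Prop :=
  spec.safe.sem ⟨env.c, env.u⟩ (join (env.φs s) 0)

end Shielded

end AdaptiveShield

end

noncomputable section

namespace AdaptiveShield

/-! ## Evaluation of terms and quantifier-free formulas -/

section Expressions

variable {Sg : Signature} {X Y : Type}

-- The remaining budget is a supermartingale-like potential: from a good state (`GoodState`: global
-- bounds and invariant hold now, all bounds and the invariant held at each recorded state), the
-- probability of ever leaving the safe set is at most the budget still available. Good states are
-- safe, so it suffices to bound the loss of goodness one transition at a time.
--
-- The one-step estimate is `lintegral_shielded_le`. The inference action is fixed before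
-- measurements are drawn, and an assignment is charged whether or not its evaluation succeeds, so
-- the budget `rem'` left after inference is deterministic (`stepAssign_snd`). There is an event `E`
-- of noise values, of probability at most the budget spent, outside of which every value assigned
-- by inference satisfies its bound (`exists_event_foldl_stepAssign`). The filtered control action
-- then preserves the invariant almost surely, so the next state is good with budget `rem'`. A cost
-- that is at most 1 everywhere and at most the budget in good states thus has expectation at most
-- `P(E) + rem'`, which is at most the initial budget.
--
-- To make `E` meaningful, all measurements are realized as functions of a single independent family
-- of noise variables (`aemeasurable_measurement_and_map`), and runtime valuations are compared with
-- a total valuation `modelVal` in which the defining equations of the observations hold. The only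
-- random failures come from aggregates (`soundInst_aggregate`). Two points matter there. A weighted
-- average of values dominates one of them, so monotonicity of the bound passes from instances to
-- the average. Moreover, the tail bound may depend on the noise through the valuation; this is
-- harmless, because the events of exceeding different valid tail bounds are nested
-- (`measure_exceeds_tail_le`).
--
-- Backward induction over a finite horizon (`traj_violatedBy_le`) turns the one-step estimate into
-- a bound for violations up to time `N`; continuity of measure along increasing events gives the
-- infinite trace.

lemma Term.eval_congr (I : Interp Sg) {w w' : X → ℝ} (θ : Term Sg X)
    (h : ∀ x ∈ θ.vars, w x = w' x) : θ.eval I w = θ.eval I w' := by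
  induction θ with
  | num r => rfl
  | var x => exact h x rfl
  | const k => rfl
  | unk f args ih =>
    simp only [Term.eval]
    congr 1
    funext i
    exact ih i fun x hx => h x (Set.mem_iUnion.2 ⟨i, hx⟩)
  | abs θ ih => simp only [Term.eval]; rw [ih h]
  | bin op θ₁ θ₂ ih₁ ih₂ =>
    simp only [Term.eval]
    rw [ih₁ fun x hx => h x (.inl hx), ih₂ fun x hx => h x (.inr hx)]

/-- Lets the runtime interpretation `constInterp`, with its dummy unknowns, be exchanged for the
true one. -/
lemma Term.eval_interp_congr {I I' : Interp Sg} (hI : I.const = I'.const) (w : X → ℝ)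
    (θ : Term Sg X) (h : θ.NoUnknown) : θ.eval I w = θ.eval I' w := by
  induction θ with
  | num r => rfl
  | var x => rfl
  | const k => simp only [Term.eval, hI]
  | unk f args ih => exact h.elim
  | abs θ ih => simp only [Term.eval]; rw [ih h]
  | bin op θ₁ θ₂ ih₁ ih₂ => simp only [Term.eval]; rw [ih₁ h.1, ih₂ h.2]

lemma Term.eval_rename (I : Interp Sg) (g : X → Y) (w : Y → ℝ) (θ : Term Sg X) :
    (θ.rename g).eval I w = θ.eval I (w ∘ g) := by
  induction θ with
  | num r => rfl
  | var x => rfl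
  | const k => rfl
  | unk f args ih => simp only [Term.rename, Term.eval, ih]
  | abs θ ih => simp only [Term.rename, Term.eval, ih]
  | bin op θ₁ θ₂ ih₁ ih₂ => simp only [Term.rename, Term.eval, ih₁, ih₂]

lemma Term.vars_rename (g : X → Y) (θ : Term Sg X) : (θ.rename g).vars = g '' θ.vars := by
  induction θ with
  | num r => simp [Term.rename, Term.vars]
  | var x => simp [Term.rename, Term.vars]
  | const k => simp [Term.rename, Term.vars]
  | unk f args ih => simp only [Term.rename, Term.vars, ih, Set.image_iUnion]
  | abs θ ih => simp only [Term.rename, Term.vars, ih]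
  | bin op θ₁ θ₂ ih₁ ih₂ => simp only [Term.rename, Term.vars, ih₁, ih₂, Set.image_union]

lemma Term.NoUnknown.rename {g : X → Y} {θ : Term Sg X} (h : θ.NoUnknown) :
    (θ.rename g).NoUnknown := by
  induction θ with
  | num r => trivial
  | var x => trivial
  | const k => trivial
  | unk f args ih => exact h.elim
  | abs θ ih => exact ih h
  | bin op θ₁ θ₂ ih₁ ih₂ => exact ⟨ih₁ h.1, ih₂ h.2⟩

lemma QF.sem_congr (I : Interp Sg) {w w' : X → ℝ} (P : QF Sg X) (h : ∀ x ∈ P.vars, w x = w' x) :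
    P.toFormula.sem I w ↔ P.toFormula.sem I w' := by
  induction P with
  | tt => simp [QF.toFormula, Formula.tt, Formula.sem, CmpOp.holds, Term.eval]
  | cmp op θ₁ θ₂ =>
    simp only [QF.toFormula, Formula.sem]
    rw [θ₁.eval_congr I fun x hx => h x (.inl hx), θ₂.eval_congr I fun x hx => h x (.inr hx)]
  | not P ih => simp only [QF.toFormula, Formula.sem]; rw [ih h]
  | or P Q ih₁ ih₂ | and P Q ih₁ ih₂ | imp P Q ih₁ ih₂ =>
    simp only [QF.toFormula, Formula.sem]
    rw [ih₁ fun x hx => h x (.inl hx), ih₂ fun x hx => h x (.inr hx)]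

lemma QF.sem_interp_congr {I I' : Interp Sg} (hI : I.const = I'.const) (w : X → ℝ) (P : QF Sg X)
    (h : P.NoUnknown) : P.toFormula.sem I w ↔ P.toFormula.sem I' w := by
  induction P with
  | tt => simp [QF.toFormula, Formula.tt, Formula.sem, CmpOp.holds, Term.eval]
  | cmp op θ₁ θ₂ =>
    simp only [QF.toFormula, Formula.sem]
    rw [θ₁.eval_interp_congr hI w h.1, θ₂.eval_interp_congr hI w h.2]
  | not P ih => simp only [QF.toFormula, Formula.sem]; rw [ih h]
  | or P Q ih₁ ih₂ | and P Q ih₁ ih₂ | imp P Q ih₁ ih₂ =>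
    simp only [QF.toFormula, Formula.sem]
    rw [ih₁ h.1, ih₂ h.2]

lemma QF.sem_rename (I : Interp Sg) (g : X → Y) (w : Y → ℝ) (P : QF Sg X) :
    (P.rename g).toFormula.sem I w ↔ P.toFormula.sem I (w ∘ g) := by
  induction P with
  | tt => simp [QF.rename, QF.toFormula, Formula.tt, Formula.sem, CmpOp.holds, Term.eval]
  | cmp op θ₁ θ₂ => simp only [QF.rename, QF.toFormula, Formula.sem, Term.eval_rename]
  | not P ih => simp only [QF.rename, QF.toFormula, Formula.sem, ih]
  | or P Q ih₁ ih₂ | and P Q ih₁ ih₂ | imp P Q ih₁ ih₂ =>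
    simp only [QF.rename, QF.toFormula, Formula.sem, ih₁, ih₂]

lemma QF.vars_rename (g : X → Y) (P : QF Sg X) : (P.rename g).vars = g '' P.vars := by
  induction P with
  | tt => simp [QF.rename, QF.vars]
  | cmp op θ₁ θ₂ => simp only [QF.rename, QF.vars, Term.vars_rename, Set.image_union]
  | not P ih => simp only [QF.rename, QF.vars, ih]
  | or P Q ih₁ ih₂ | and P Q ih₁ ih₂ | imp P Q ih₁ ih₂ =>
    simp only [QF.rename, QF.vars, ih₁, ih₂, Set.image_union]

/-- Unknowns are arbitrary functions and may fail to be measurable; the remaining operations are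
continuous. -/
lemma Term.measurable_eval_comp {Ω : Type*} [MeasurableSpace Ω] (I : Interp Sg) (θ : Term Sg X)
    (h : θ.NoUnknown) (f : Ω → X → ℝ) (hf : ∀ x ∈ θ.vars, Measurable fun o => f o x) :
    Measurable fun o => θ.eval I (f o) := by
  induction θ with
  | num r => exact measurable_const
  | var x => exact hf x rfl
  | const k => exact measurable_const
  | unk f args ih => exact h.elim
  | abs θ ih => exact (ih h hf).norm
  | bin op θ₁ θ₂ ih₁ ih₂ =>
    have h₁ := ih₁ h.1 fun x hx => hf x (.inl hx)
    have h₂ := ih₂ h.2 fun x hx => hf x (.inr hx)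
    cases op
    exacts [h₁.add h₂, h₁.mul h₂, h₁.min h₂, h₁.max h₂]

variable {n : ℕ}

lemma eval_weightedSum (I : Interp Sg) (w : SVar Sg → ℝ) (D : List (ℝ × (Fin n → ℕ)))
    (θ : Term Sg (IVar Sg n)) :
    (weightedSum D θ).eval I w = (D.map fun d => d.1 * θ.eval I (w ∘ inst d.2)).sum := by
  induction D with
  | nil => rfl
  | cons d D ih =>
    change _ + (weightedSum D θ).eval I w = _
    rw [ih, List.map_cons, List.sum_cons]
    simp only [Term.eval, Term.eval_rename]
    rfl

lemma mem_vars_weightedSum {D : List (ℝ × (Fin n → ℕ))} {θ : Term Sg (IVar Sg n)} {x : SVar Sg} :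
    x ∈ (weightedSum D θ).vars ↔ ∃ d ∈ D, ∃ y ∈ θ.vars, inst d.2 y = x := by
  induction D with
  | nil => simp [weightedSum, Term.vars]
  | cons d D ih =>
    change x ∈ (∅ ∪ (θ.rename (inst d.2)).vars) ∪ (weightedSum D θ).vars ↔ _
    rw [Set.mem_union, ih, Set.empty_union, Term.vars_rename]
    simp [Set.mem_image]

lemma sem_conjGuard (I : Interp Sg) (w : SVar Sg → ℝ) (D : List (ℝ × (Fin n → ℕ)))
    (G : QF Sg (IVar Sg n)) :
    (conjGuard D G).toFormula.sem I w ↔ ∀ d ∈ D, G.toFormula.sem I (w ∘ inst d.2) := by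
  induction D with
  | nil => simp [conjGuard, QF.toFormula, Formula.tt, Formula.sem, CmpOp.holds]
  | cons d D ih =>
    change (Formula.and _ (conjGuard D G).toFormula).sem I w ↔ _
    simp only [Formula.sem, ih, QF.sem_rename, List.forall_mem_cons]

lemma mem_vars_conjGuard {D : List (ℝ × (Fin n → ℕ))} {G : QF Sg (IVar Sg n)} {x : SVar Sg} :
    x ∈ (conjGuard D G).vars ↔ ∃ d ∈ D, ∃ y ∈ G.vars, inst d.2 y = x := by
  induction D with
  | nil => simp [conjGuard, QF.vars]
  | cons d D ih =>
    change x ∈ (G.rename (inst d.2)).vars ∪ (conjGuard D G).vars ↔ _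
    rw [Set.mem_union, ih, QF.vars_rename]
    simp [Set.mem_image]

end Expressions

/-! ## Controllers and their monitors -/

section Controllers

variable {Sg : Signature}

lemma Ctrl.sem_exec_of_monitor (I : Interp Sg) (α : Ctrl Sg) (w : DLVar Sg → ℝ) (a : α.Act)
    (h : α.monitor I w a) : α.toProgram.sem I w (α.exec I w a) := by
  induction α generalizing w with
  | assign x θ => simp only [Ctrl.toProgram, Program.sem, Ctrl.exec]
  | random x => simp only [Ctrl.toProgram, Program.sem]; exact ⟨a, by simp only [Ctrl.exec]⟩
  | test Q => exact ⟨rfl, h⟩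
  | choice α β ihα ihβ =>
    rcases a with a | a
    · exact .inl (ihα w a h)
    · exact .inr (ihβ w a h)
  | seq α β ihα ihβ =>
    obtain ⟨a₁, a₂⟩ := a
    exact ⟨_, ihα w a₁ h.1, ihβ _ a₂ h.2⟩

/-- A run determines how its choices were resolved. This turns totality of the controller into the
existence of an action that the monitor permits, which is what the fallback needs. -/
lemma Ctrl.exists_monitor_of_sem (I : Interp Sg) (α : Ctrl Sg) (w t : DLVar Sg → ℝ)
    (h : α.toProgram.sem I w t) : ∃ a, α.monitor I w a ∧ α.exec I w a = t := by
  induction α generalizing w t with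
  | assign x θ =>
    refine ⟨(), trivial, ?_⟩
    simp only [Ctrl.toProgram, Program.sem] at h
    rw [h]; simp only [Ctrl.exec]
  | random x =>
    simp only [Ctrl.toProgram, Program.sem] at h
    obtain ⟨r, rfl⟩ := h
    exact ⟨r, trivial, by simp only [Ctrl.exec]⟩
  | test Q => exact ⟨(), h.2, h.1.symm⟩
  | choice α β ihα ihβ =>
    rcases h with h | h
    · obtain ⟨a, h₁, h₂⟩ := ihα w t h; exact ⟨.inl a, h₁, h₂⟩
    · obtain ⟨a, h₁, h₂⟩ := ihβ w t h; exact ⟨.inr a, h₁, h₂⟩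
  | seq α β ihα ihβ =>
    obtain ⟨m, hm, ht⟩ := h
    obtain ⟨a₁, h₁, rfl⟩ := ihα w m hm
    obtain ⟨a₂, h₂, h₃⟩ := ihβ _ t ht
    exact ⟨(a₁, a₂), ⟨h₁, h₂⟩, h₃⟩

lemma Ctrl.exec_interp_congr {I I' : Interp Sg} (hI : I.const = I'.const) (α : Ctrl Sg)
    (hα : α.WellFormed) (w : DLVar Sg → ℝ) (a : α.Act) : α.exec I w a = α.exec I' w a := by
  induction α generalizing w with
  | assign x θ => simp only [Ctrl.exec]; rw [θ.eval_interp_congr hI w hα.1]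
  | random x => rfl
  | test Q => rfl
  | choice α β ihα ihβ =>
    rcases a with a | a
    · exact ihα hα.1 w a
    · exact ihβ hα.2 w a
  | seq α β ihα ihβ =>
    obtain ⟨a₁, a₂⟩ := a
    simp only [Ctrl.exec]
    rw [ihα hα.1, ihβ hα.2]

lemma Ctrl.monitor_interp_congr {I I' : Interp Sg} (hI : I.const = I'.const) (α : Ctrl Sg)
    (hα : α.WellFormed) (w : DLVar Sg → ℝ) (a : α.Act) :
    α.monitor I w a ↔ α.monitor I' w a := by
  induction α generalizing w with
  | assign x θ => rfl
  | random x => rfl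
  | test Q => exact Q.sem_interp_congr hI w hα.1
  | choice α β ihα ihβ =>
    rcases a with a | a
    · exact ihα hα.1 w a
    · exact ihβ hα.2 w a
  | seq α β ihα ihβ =>
    obtain ⟨a₁, a₂⟩ := a
    simp only [Ctrl.monitor]
    rw [ihα hα.1, α.exec_interp_congr hI hα.1, ihβ hα.2]

end Controllers

/-! ## Product measures -/

section ProductMeasures

/-- Used to extract the noise of the finitely many history positions from the family over all
indices. -/
lemma infinitePi_map_embedding {ι κ X : Type*} [MeasurableSpace X] [Fintype κ] (μ : ι → Measure X)
    [∀ i, IsProbabilityMeasure (μ i)] (e : κ ↪ ι) :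
    (Measure.infinitePi μ).map (fun x k => x (e k)) = Measure.pi fun k => μ (e k) := by
  classical
  refine (Measure.pi_eq fun t ht => ?_).symm
  rw [Measure.map_apply (by fun_prop) (.univ_pi ht)]
  -- A box over `κ` pulls back to a cylinder that is unconstrained off the range of `e`.
  set t' : ι → Set X := Function.extend e t fun _ => Set.univ with ht'
  have hext : ∀ k, t' (e k) = t k := fun k => e.injective.extend_apply _ _ _
  have : (fun (x : ι → X) k => x (e k)) ⁻¹' (Set.univ.pi t)
      = Set.pi (Finset.univ.map e : Finset ι) t' := by
    ext x
    simp [Set.mem_pi, hext]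
  rw [this, Measure.infinitePi_pi]
  · simp [hext]
  · intro i hi
    obtain ⟨k, -, rfl⟩ := Finset.mem_map.1 hi
    rw [hext]
    exact ht k

open Classical in
/-- Two doubly indexed product laws agree on events that only depend on coordinates whose laws
agree. -/
lemma infinitePi_infinitePi_congr {ι κ : Type*} (μ ν : ι → κ → Measure ℝ)
    [∀ i k, IsProbabilityMeasure (μ i k)] [∀ i k, IsProbabilityMeasure (ν i k)]
    (R : Set (ι × κ)) (h : ∀ p ∈ R, μ p.1 p.2 = ν p.1 p.2) {A : Set (ι → κ → ℝ)}
    (hA : MeasurableSet A)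
    (hdep : ∀ x y : ι → κ → ℝ, (∀ p ∈ R, x p.1 p.2 = y p.1 p.2) → x ∈ A → y ∈ A) :
    (Measure.infinitePi fun i => Measure.infinitePi (μ i)) A
      = (Measure.infinitePi fun i => Measure.infinitePi (ν i)) A := by
  -- Coordinates outside `R` are filled with 0; membership in `A` does not see them.
  set e : (R → ℝ) → ι → κ → ℝ := fun z i k => if hp : (i, k) ∈ R then z ⟨(i, k), hp⟩ else 0
    with he
  have hem : Measurable e := by
    refine measurable_pi_lambda _ fun i => measurable_pi_lambda _ fun k => ?_
    by_cases hp : (i, k) ∈ R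
    · simp only [he, hp, dite_true]; fun_prop
    · simp only [he, hp, dite_false]; fun_prop
  -- Uncurrying and restricting to `R` expresses the measure of `A` through the marginals in `R`
  -- alone, and those coincide for `μ` and `ν`.
  have key : ∀ (ρ : ι → κ → Measure ℝ) [∀ i k, IsProbabilityMeasure (ρ i k)],
      (Measure.infinitePi fun i => Measure.infinitePi (ρ i)) A
        = (Measure.infinitePi fun p : R => ρ p.1.1 p.1.2) (e ⁻¹' A) := by
    intro ρ _
    rw [← Measure.infinitePi_map_restrict' (μ := fun p : ι × κ => ρ p.1 p.2) (I := R),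
      ← Measure.infinitePi_map_curry_symm ρ, Measure.map_map (by fun_prop) (by fun_prop),
      Measure.map_apply (by fun_prop) (hem hA)]
    congr 1
    ext x
    have hx : ∀ p ∈ R, x p.1 p.2 =
        e (Set.domRestrict R ((MeasurableEquiv.curry ι κ ℝ).symm x)) p.1 p.2 := by
      intro p hp
      simp only [he, Prod.mk.eta, hp, dite_true]
      rfl
    exact ⟨hdep _ _ hx, hdep _ _ fun p hp => (hx p hp).symm⟩
  rw [key μ, key ν]
  congr 2
  funext p
  exact h p.1 p.2

/-- The event that a random variable exceeds some of its upper tail bounds of tolerance `ε` has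
measure at most `ε`. -/
lemma measure_exceeds_tail_le {Ω : Type*} [MeasurableSpace Ω] (Q : Measure Ω) (f : Ω → ℝ)
    (ε : ℝ≥0∞) : Q {η | ∃ b : ℝ, Q {ξ | b < f ξ} ≤ ε ∧ b < f η} ≤ ε := by
  -- A rational between `b` and `f η` is again a valid tail bound, so countably many bounds suffice.
  have hsub : {η | ∃ b : ℝ, Q {ξ | b < f ξ} ≤ ε ∧ b < f η} ⊆
      ⋃ q : {q : ℚ // Q {ξ | (q : ℝ) < f ξ} ≤ ε}, {η | ((q : ℚ) : ℝ) < f η} := by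
    rintro η ⟨b, hb, hbη⟩
    obtain ⟨q, hq₁, hq₂⟩ := exists_rat_btwn hbη
    exact Set.mem_iUnion.2 ⟨⟨q, (measure_mono fun ξ (hξ : (q : ℝ) < f ξ) =>
      hq₁.trans hξ).trans hb⟩, hq₂⟩
  refine (measure_mono hsub).trans ?_
  -- The events are nested, so the measure of the union is a supremum and not a sum.
  rw [Directed.measure_iUnion]
  · exact iSup_le fun q => q.2
  · intro q q'
    rcases le_total q.1 q'.1 with h | h
    · exact ⟨q, subset_rfl, fun η (hη : ((q' : ℚ) : ℝ) < f η) =>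
        lt_of_le_of_lt (by exact_mod_cast h) hη⟩
    · exact ⟨q', fun η (hη : ((q : ℚ) : ℝ) < f η) =>
        lt_of_le_of_lt (by exact_mod_cast h) hη, subset_rfl⟩

end ProductMeasures

/-! ## Noise laws -/

section Noise

variable {Sg : Signature}

instance (I : Interp Sg) (w : DLVar Sg → ℝ) (d : Dist Sg) : IsProbabilityMeasure (d.law I w) := by
  cases d with
  | normal θ₁ θ₂ => simp only [Dist.law]; infer_instance
  | uniform θ₁ θ₂ =>
    simp only [Dist.law]
    split_ifs with h
    · refine cond_isProbabilityMeasure_of_finite ?_ ?_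
      · simpa using h
      · simp
    · infer_instance
  | bernoulli θ => simp only [Dist.law]; infer_instance

lemma Dist.law_congr (I : Interp Sg) {w w' : DLVar Sg → ℝ} (d : Dist Sg)
    (h : ∀ x ∈ d.vars, w x = w' x) : d.law I w = d.law I w' := by
  cases d with
  | normal θ₁ θ₂ | uniform θ₁ θ₂ =>
    simp only [Dist.law]
    rw [θ₁.eval_congr I fun x hx => h x (.inl hx), θ₂.eval_congr I fun x hx => h x (.inr hx)]
  | bernoulli θ => simp only [Dist.law]; rw [θ.eval_congr I h]

variable (spec : ShieldSpec Sg)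

instance (c : Sg.Const → ℝ) (w : DLVar Sg → ℝ) : IsProbabilityMeasure (spec.noiseLaw c w) := by
  unfold ShieldSpec.noiseLaw; infer_instance

/-- The joint law of all indexed noise variables, those with index `i` being distributed as in the
state `W i`. -/
def ShieldSpec.stateNoiseLaw (c : Sg.Const → ℝ) (W : Option ℕ → DLVar Sg → ℝ) :
    Measure (Option ℕ → Sg.NoiseVar → ℝ) :=
  Measure.infinitePi fun i => spec.noiseLaw c (W i)

instance (c : Sg.Const → ℝ) (W : Option ℕ → DLVar Sg → ℝ) :
    IsProbabilityMeasure (spec.stateNoiseLaw c W) := by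
  unfold ShieldSpec.stateNoiseLaw; infer_instance

/-- The valuation of noise variables by `η` and of all other variables by `W`. -/
def noisyVal (W : Option ℕ → DLVar Sg → ℝ) (η : Option ℕ → Sg.NoiseVar → ℝ) : SVar Sg → ℝ
  | (.noise y, i) => η i y
  | (x, i) => W i x

/-- A tail bound returned on a valuation `v` is a tail bound with respect to the noise law given by
`W` if `v` agrees with `W` on the state variables. -/
lemma ShieldSpec.IsInvCCDF.stateNoiseLaw_le {spec : ShieldSpec Sg} (hwf : spec.WellFormed)
    {tail : TailFun Sg} (htail : spec.IsInvCCDF tail) {c : Sg.Const → ℝ}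
    {W : Option ℕ → DLVar Sg → ℝ} {v : PVal Sg}
    (hv : ∀ x i r, v (.state x, i) = some r → W i (.state x) = r)
    {θ : Term Sg (SVar Sg)} (hdef : spec.TailDefined v θ)
    (hθ : ∀ x ∈ θ.vars, (∃ y, x.1 = .state y) ∨ ∃ y, x.1 = .noise y)
    {ε : unitInterval} {b : ℝ} (hb : tail c v θ ε = some b) :
    spec.stateNoiseLaw c W {η | b < θ.eval (constInterp c) (noisyVal W η)}
      ≤ ENNReal.ofReal (ε : ℝ) := by
  have hval : ∀ η, θ.eval (constInterp c) (noisyVal W η)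
      = θ.eval (constInterp c) (withNoise v η) := by
    intro η
    refine θ.eval_congr _ ?_
    rintro ⟨y, i⟩ hx
    rcases hθ _ hx with ⟨z, hz⟩ | ⟨z, hz⟩ <;> dsimp only at hz <;> subst hz
    · have := hdef.2 _ hx
      obtain ⟨r, hr⟩ := Option.isSome_iff_exists.1 this
      simp only [noisyVal, withNoise, PVal.total, hr, hv z i r hr, Option.getD_some]
    · rfl
  have hmeas : Measurable fun η => θ.eval (constInterp c) (withNoise v η) := by
    refine θ.measurable_eval_comp _ hdef.1 _ ?_
    rintro ⟨y, i⟩ hx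
    rcases hθ _ hx with ⟨z, hz⟩ | ⟨z, hz⟩ <;> dsimp only at hz <;> subst hz
    · exact measurable_const
    · simp only [withNoise]; fun_prop
  simp only [hval]
  refine le_trans (le_of_eq ?_) (htail c v θ ε b hdef hb)
  -- Undefined states read as 0 in `indexedNoiseLaw`, so the two laws may differ globally. They
  -- agree on the noise occurring in `θ`, since `TailDefined` forces `v` to define everything its
  -- distribution depends on.
  refine infinitePi_infinitePi_congr _ _ {p | (DLVar.noise p.2, p.1) ∈ θ.vars} ?_
    (measurableSet_lt measurable_const hmeas) ?_
  · rintro ⟨i, y⟩ hp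
    refine Dist.law_congr _ _ fun x hx => ?_
    obtain ⟨z, rfl⟩ := (hwf.noise_wf y).2 hx
    obtain ⟨r, hr⟩ := Option.isSome_iff_exists.1 (hdef.2 _ hp _ hx)
    simp only [PVal.total, hr, hv z i r hr, Option.getD_some]
  · intro ξ ξ' hξ hA
    have : θ.eval (constInterp c) (withNoise v ξ) = θ.eval (constInterp c) (withNoise v ξ') := by
      refine θ.eval_congr _ ?_
      rintro ⟨y, i⟩ hx
      rcases hθ _ hx with ⟨z, hz⟩ | ⟨z, hz⟩ <;> dsimp only at hz <;> subst hz
      · rfl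
      · exact hξ (i, z) hx
    simpa only [Set.mem_ofPred_eq, this] using hA

end Noise

/-! ## Soundness of symbolic inference assignments -/

section Inference

variable {Sg : Signature} {S : Type*}

/-- If all values exceeded their average, averaging them would give a number exceeding itself. -/
lemma exists_le_weighted_sum {J : Type} (D : FDistr J) (t : J → ℝ) :
    ∃ d ∈ D.1, t d.2 ≤ (D.1.map fun d => d.1 * t d.2).sum := by
  by_contra! h
  set T := (D.1.map fun d => d.1 * t d.2).sum with hT
  have hne : D.1 ≠ [] := by
    intro h0
    have := D.2.2
    simp [h0] at this
  obtain ⟨d, hd⟩ := List.exists_mem_of_ne_nil _ hne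
  have hlt : (D.1.map fun d => d.1 * T).sum < T := by
    conv_rhs => rw [hT]
    refine List.sum_lt_sum _ _ (fun d hd => ?_) ⟨d, hd, ?_⟩
    · exact mul_le_mul_of_nonneg_left (h d hd).le (D.2.1 d hd).le
    · exact mul_lt_mul_of_pos_left (h d hd) (D.2.1 d hd)
  rw [List.sum_map_mul_right, D.2.2, one_mul] at hlt
  exact lt_irrefl _ hlt

lemma exists_weighted_sum_le {J : Type} (D : FDistr J) (t : J → ℝ) :
    ∃ d ∈ D.1, (D.1.map fun d => d.1 * t d.2).sum ≤ t d.2 := by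
  obtain ⟨d, hd, h⟩ := exists_le_weighted_sum D fun j => - t j
  refine ⟨d, hd, ?_⟩
  have : (D.1.map fun d => d.1 * -t d.2) = D.1.map fun d => (-1) * (d.1 * t d.2) := by
    simp
  rw [this, List.sum_map_mul_left] at h
  linarith

variable (spec : ShieldSpec Sg)

/-- The total valuation of indexed variables determined by the state and parameter values `pt i`
attached to each index `i` and by the values `η` of all noise variables. -/
def modelVal (I : Interp Sg) (φs : S → Sg.StateVar → ℝ)
    (pt : Option ℕ → Option (S × (Sg.Param → ℝ))) (η : Option ℕ → Sg.NoiseVar → ℝ) : SVar Sg → ℝ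
  | (.noise y, i) => η i y
  | (.obs ω, i) => (pt i).elim 0 fun q => (spec.obs ω).eval I (joinNoise (φs q.1) (η i))
  | (.state x, i) => (pt i).elim 0 fun q => φs q.1 x
  | (.param p, i) => (pt i).elim 0 fun q => q.2 p
  | (.aux _, _) => 0

/-- The partial valuation `v` only records facts about the model: its entries agree with `modelVal`,
every index carries a state satisfying the invariant, and recorded parameters satisfy their
bounds. -/
structure Consistent (I : Interp Sg) (φs : S → Sg.StateVar → ℝ)
    (pt : Option ℕ → Option (S × (Sg.Param → ℝ))) (η : Option ℕ → Sg.NoiseVar → ℝ)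
    (v : PVal Sg) : Prop where
  agree : ∀ x r, v x = some r → modelVal spec I φs pt η x = r
  located : ∀ y i r, v (y, i) = some r → (∃ q, pt i = some q) ∧
    ((∃ x, y = .state x) ∨ (∃ p, y = .param p) ∨ ∃ ω, y = .obs ω)
  inv : ∀ i q, pt i = some q → spec.inv.sem I (join (φs q.1) q.2)
  bound : ∀ p i r q, v (.param p, i) = some r → pt i = some q →
    (spec.bound p).sem I (join (φs q.1) q.2)

variable {spec} {I : Interp Sg} {φs : S → Sg.StateVar → ℝ}
  {pt : Option ℕ → Option (S × (Sg.Param → ℝ))} {η : Option ℕ → Sg.NoiseVar → ℝ} {v : PVal Sg}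

/-- This discharges the premises of the inference obligations: observations satisfy their equation
by construction of `modelVal`, while states and parameters are covered by the fields `inv` and
`bound`. -/
lemma Consistent.varDef (hwf : spec.WellFormed) (hv : Consistent spec I φs pt η v) {n : ℕ}
    (j : Fin n → ℕ) (y : IVar Sg n) (hy : (∃ z, y.1 = .noise z) ∨ (v (inst j y)).isSome) :
    spec.varDef I (modelVal spec I φs pt η ∘ inst j) y := by
  rcases hy with ⟨z, hz⟩ | hy
  · obtain ⟨y, i⟩ := y
    dsimp only at hz
    subst hz
    trivial
  obtain ⟨r, hr⟩ := Option.isSome_iff_exists.1 hy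
  obtain ⟨y, i⟩ := y
  obtain ⟨⟨q, hq⟩, hy'⟩ := hv.located y (i.map j) r hr
  rcases hy' with ⟨x, rfl⟩ | ⟨p, rfl⟩ | ⟨ω, rfl⟩
  · refine (hwf.inv_free I _ _ ?_).1 (hv.inv _ q hq)
    rintro _ (⟨z, rfl⟩ | ⟨z, -, rfl⟩) <;> simp [inst, modelVal, hq, join]
  · refine (hwf.bound_free p I _ _ ?_).1 (hv.bound p _ r q hr hq)
    rintro _ (⟨z, rfl⟩ | rfl) <;> simp [inst, modelVal, hq, join]
  · simp only [ShieldSpec.varDef, Function.comp_apply, inst, modelVal, hq, Option.elim_some]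
    refine Term.eval_congr _ _ fun x hx => ?_
    rcases hwf.obs_wf ω hx with ⟨z, rfl⟩ | ⟨z, rfl⟩ <;> simp [joinNoise, hq]

lemma Consistent.eval_eq (hv : Consistent spec I φs pt η v) {θ : Term Sg (SVar Sg)}
    (hθ : θ.NoUnknown) (hdef : v.DefinedOn θ.vars) :
    θ.eval (constInterp I.const) v.total = θ.eval I (modelVal spec I φs pt η) := by
  rw [θ.eval_interp_congr (I := constInterp I.const) (I' := I) rfl _ hθ]
  refine θ.eval_congr I fun x hx => ?_
  obtain ⟨r, hr⟩ := Option.isSome_iff_exists.1 (hdef x hx)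
  rw [hv.agree x r hr, PVal.total, hr, Option.getD_some]

lemma Consistent.sem_iff (hv : Consistent spec I φs pt η v) {P : QF Sg (SVar Sg)}
    (hP : P.NoUnknown) (hdef : v.DefinedOn P.vars) :
    P.toFormula.sem (constInterp I.const) v.total
      ↔ P.toFormula.sem I (modelVal spec I φs pt η) := by
  rw [P.sem_interp_congr (I := constInterp I.const) (I' := I) rfl _ hP]
  refine P.sem_congr I fun x hx => ?_
  obtain ⟨r, hr⟩ := Option.isSome_iff_exists.1 (hdef x hx)
  rw [hv.agree x r hr, PVal.total, hr, Option.getD_some]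

variable (spec) in
open Classical in
/-- The value `r` satisfies the bound of `p` in the current state. -/
def BoundHolds (I : Interp Sg) (φs : S → Sg.StateVar → ℝ)
    (pt : Option ℕ → Option (S × (Sg.Param → ℝ))) (η : Option ℕ → Sg.NoiseVar → ℝ)
    (p : Sg.Param) (r : ℝ) : Prop :=
  (spec.bound p).sem I
    (Function.update (fun y => modelVal spec I φs pt η (y, none)) (.param p) r)

lemma Consistent.boundHolds_instance (hwf : spec.WellFormed) (hA : ∀ w, spec.Assum I w)
    (hv : Consistent spec I φs pt η v) {p : Sg.Param} {n : ℕ} {V : Set (IVar Sg n)}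
    {G : QF Sg (IVar Sg n)} {θ : Term Sg (IVar Sg n)} (hob : spec.obligation p V G θ)
    (j : Fin n → ℕ) (hV : ∀ y ∈ V, (∃ z, y.1 = .noise z) ∨ (v (inst j y)).isSome)
    (hG : G.toFormula.sem I (modelVal spec I φs pt η ∘ inst j)) :
    BoundHolds spec I φs pt η p (θ.eval I (modelVal spec I φs pt η ∘ inst j)) :=
  hob I (modelVal spec I φs pt η ∘ inst j) (hA _) (fun y hy => hv.varDef hwf j y (hV y hy)) hG

lemma Consistent.boundHolds_guard_term (hwf : spec.WellFormed) (hA : ∀ w, spec.Assum I w)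
    (tail : TailFun Sg)
    (hv : Consistent spec I φs pt η v) {p : Sg.Param} {n : ℕ}
    {G : QF Sg (IVar Sg n)} {θ : Term Sg (IVar Sg n)}
    (hob : spec.obligation p (θ.vars ∪ G.vars) G θ) (j : Fin n → ℕ) {r : ℝ}
    (hr : spec.evalInst tail I.const v
      (.guard (.term (θ.rename (inst j))) (G.rename (inst j))) = some r) :
    BoundHolds spec I φs pt η p r := by
  simp only [ShieldSpec.evalInst] at hr
  split_ifs at hr with h₁ h₂
  obtain rfl := Option.some.inj hr
  rw [hv.eval_eq h₂.1 h₂.2, Term.eval_rename]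
  refine hv.boundHolds_instance hwf hA hob j ?_ ?_
  · rintro y (hy | hy)
    · exact .inr (h₂.2 _ (by rw [Term.vars_rename]; exact ⟨y, hy, rfl⟩))
    · exact .inr (h₁.2.1 _ (by rw [QF.vars_rename]; exact ⟨y, hy, rfl⟩))
  · exact (QF.sem_rename _ _ _ _).1 ((hv.sem_iff h₁.1 h₁.2.1).1 h₁.2.2)

/-- The left side mentions neither `pt` nor `v`, so the exceptional event can be fixed from the
states `W` before any measurement is known. -/
lemma Consistent.tail_eval_eq (hv : Consistent spec I φs pt η v)
    {W : Option ℕ → DLVar Sg → ℝ} (hW : ∀ i q, pt i = some q → ∀ x, W i (.state x) = φs q.1 x)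
    {θ : Term Sg (SVar Sg)} (hdef : spec.TailDefined v θ)
    (hθ : ∀ x ∈ θ.vars, (∃ y, x.1 = .state y) ∨ ∃ y, x.1 = .noise y) :
    θ.eval (constInterp I.const) (noisyVal W η) = θ.eval I (modelVal spec I φs pt η) := by
  rw [θ.eval_interp_congr (I := constInterp I.const) (I' := I) rfl _ hdef.1]
  refine θ.eval_congr I ?_
  rintro ⟨y, i⟩ hx
  rcases hθ _ hx with ⟨z, hz⟩ | ⟨z, hz⟩ <;> dsimp only at hz <;> subst hz
  · obtain ⟨r, hr⟩ := Option.isSome_iff_exists.1 (hdef.2 _ hx)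
    obtain ⟨⟨q, hq⟩, -⟩ := hv.located _ _ _ hr
    simp [noisyVal, modelVal, hq, hW i q hq]
  · rfl

lemma BoundHolds.mono (hwf : spec.WellFormed) {p : Sg.Param} (hd : spec.dir p = .up) {x y : ℝ}
    (hxy : x ≤ y) (h : BoundHolds spec I φs pt η p x) : BoundHolds spec I φs pt η p y :=
  hwf.bound_mono p hd I _ x y hxy h

lemma BoundHolds.anti (hwf : spec.WellFormed) {p : Sg.Param} (hd : spec.dir p = .lo) {x y : ℝ}
    (hxy : x ≤ y) (h : BoundHolds spec I φs pt η p y) : BoundHolds spec I φs pt η p x :=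
  hwf.bound_anti p hd I _ x y hxy h

/-- The instantiation `e`, when used for the parameter `p`, yields values satisfying the bound of
`p` outside of an event of probability at most `ε`. -/
def SoundInst (spec : ShieldSpec Sg) (I : Interp Sg) (φs : S → Sg.StateVar → ℝ)
    (tail : TailFun Sg) (W : Option ℕ → DLVar Sg → ℝ)
    (a : Sg.Param × SBInst Sg × unitInterval) : Prop :=
  ∃ E : Set (Option ℕ → Sg.NoiseVar → ℝ),
    spec.stateNoiseLaw I.const W E ≤ ENNReal.ofReal (a.2.2 : ℝ) ∧
    ∀ η ∉ E, ∀ pt v, (∀ i q, pt i = some q → ∀ x, W i (.state x) = φs q.1 x) →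
      Consistent spec I φs pt η v → ∀ r, spec.evalInst tail I.const v a.2.1 = some r →
      BoundHolds spec I φs pt η a.1 r

/-- The exceptional event must be chosen before `pt` and `v`, which may depend on the noise. This is
possible because the noise component contains no observations and no parameters: as a random
variable it depends only on the fixed states. -/
lemma soundInst_aggregate (hwf : spec.WellFormed) (hA : ∀ w, spec.Assum I w) {tail : TailFun Sg}
    (htail : spec.IsInvCCDF tail) (W : Option ℕ → DLVar Sg → ℝ) {p : Sg.Param} {n : ℕ}
    {θ₁ θ₂ : Term Sg (IVar Sg n)} {G : QF Sg (IVar Sg n)}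
    (hob : spec.obligation p (θ₁.vars ∪ θ₂.vars ∪ G.vars) G (.bin .add θ₁ θ₂))
    (hθ : (IExpr.aggregate n θ₁ θ₂ G).WellFormed) (ε : unitInterval) (D : FDistr (Fin n → ℕ)) :
    SoundInst spec I φs tail W (p, .guard (.add (.term (weightedSum D.1 θ₁))
      (tailInst ε (weightedSum D.1 θ₂) (spec.dir p))) (conjGuard D.1 G), ε) := by
  obtain ⟨-, hobs, hpar⟩ := hθ
  have hnoise : ∀ {v : PVal Sg} {θ : Term Sg (SVar Sg)}, spec.TailDefined v θ →
      θ.vars ⊆ (weightedSum D.1 θ₂).vars → ∀ {pt η}, Consistent spec I φs pt η v →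
      ∀ x ∈ θ.vars, (∃ y, x.1 = .state y) ∨ ∃ y, x.1 = .noise y := by
    intro v θ hdef hsub pt η hv x hx
    obtain ⟨d, -, ⟨z, i⟩, hz, rfl⟩ := mem_vars_weightedSum.1 (hsub hx)
    have := hdef.2 _ hx
    match z, hz, this with
    | .state y, _, _ => exact .inl ⟨y, rfl⟩
    | .noise y, _, _ => exact .inr ⟨y, rfl⟩
    | .obs y, hz, _ => exact (hobs y i hz).elim
    | .param y, hz, _ => exact (hpar y i hz).elim
    -- A consistent valuation never defines an auxiliary variable.
    | .aux y, _, hsome =>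
      obtain ⟨r, hr⟩ := Option.isSome_iff_exists.1 hsome
      simpa using (hv.located _ _ _ hr).2
  have hinst : ∀ {pt η} {v : PVal Sg}, Consistent spec I φs pt η v →
      v.DefinedOn (weightedSum D.1 θ₁).vars →
      (∀ y ∈ (weightedSum D.1 θ₂).vars, (∃ z, y.1 = .noise z) ∨ (v y).isSome) →
      (conjGuard D.1 G).NoUnknown → v.DefinedOn (conjGuard D.1 G).vars →
      (conjGuard D.1 G).toFormula.sem (constInterp I.const) v.total → ∀ d ∈ D.1,
      BoundHolds spec I φs pt η p ((Term.bin .add θ₁ θ₂).eval I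
        (modelVal spec I φs pt η ∘ inst d.2)) := by
    intro pt η v hv h₁ h₂ hG₁ hG₂ hG₃ d hd
    refine hv.boundHolds_instance hwf hA hob d.2 ?_ ?_
    · rintro y ((hy | hy) | hy)
      · exact .inr (h₁ _ (mem_vars_weightedSum.2 ⟨d, hd, y, hy, rfl⟩))
      · exact h₂ _ (mem_vars_weightedSum.2 ⟨d, hd, y, hy, rfl⟩)
      · exact .inr (hG₂ _ (mem_vars_conjGuard.2 ⟨d, hd, y, hy, rfl⟩))
    · exact (sem_conjGuard _ _ _ _).1 ((hv.sem_iff hG₁ hG₂).1 hG₃) d hd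
  have hsplit : ∀ {v : PVal Sg} {θ : Term Sg (SVar Sg)}, spec.TailDefined v θ →
      ∀ y ∈ θ.vars, (∃ z, y.1 = .noise z) ∨ (v y).isSome := by
    rintro v θ hdef ⟨z, i⟩ hy
    have := hdef.2 _ hy
    match z, this with
    | .noise y, _ => exact .inl ⟨y, rfl⟩
    | .state y, h | .obs y, h | .param y, h | .aux y, h => exact .inr h
  -- The obligation concerns `θ₁ + θ₂` at single index tuples, while evaluation treats the two
  -- averaged components separately.
  have hsum : ∀ w : SVar Sg → ℝ, (D.1.map fun d => d.1 * (Term.bin .add θ₁ θ₂).eval I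
      (w ∘ inst d.2)).sum
        = (weightedSum D.1 θ₁).eval I w + (weightedSum D.1 θ₂).eval I w := by
    intro w
    rw [eval_weightedSum, eval_weightedSum, ← List.sum_map_add]
    simp only [Term.eval, ArithOp.eval, mul_add]
  have hWv : ∀ {pt η} {v : PVal Sg}, (∀ i q, pt i = some q → ∀ x, W i (.state x) = φs q.1 x) →
      Consistent spec I φs pt η v → ∀ x i r, v (.state x, i) = some r → W i (.state x) = r := by
    intro pt η v hW hv x i r hr
    obtain ⟨⟨q, hq⟩, -⟩ := hv.located _ _ _ hr
    have := hv.agree _ _ hr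
    simpa [modelVal, hq, hW i q hq] using this
  cases hd : spec.dir p with
  | up =>
    set X := weightedSum D.1 θ₂ with hX
    -- The event is that the noise term exceeds some valid tail bound. It covers whichever bound
    -- `tail` returns, even if that bound depends on the noise.
    refine ⟨_, measure_exceeds_tail_le _
      (fun η => X.eval (constInterp I.const) (noisyVal W η)) _, ?_⟩
    intro η hη pt v hW hv r hr
    simp only [ShieldSpec.evalInst, tailInst] at hr
    split_ifs at hr with h₁ h₂ h₃ <;> try simp at hr
    obtain ⟨b, hb, rfl⟩ := hr
    have hXs := hnoise h₃ subset_rfl hv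
    have hle : X.eval I (modelVal spec I φs pt η) ≤ b := by
      rw [← hv.tail_eval_eq hW h₃ hXs]
      by_contra! hlt
      exact hη ⟨b, htail.stateNoiseLaw_le hwf (hWv hW hv) h₃ hXs hb, hlt⟩
    -- One true instance below the average is enough: the upper bound then holds at the average, and
    -- so at the larger returned value.
    obtain ⟨d, hdD, hdle⟩ := exists_le_weighted_sum D fun j =>
      (Term.bin .add θ₁ θ₂).eval I (modelVal spec I φs pt η ∘ inst j)
    refine (hinst hv h₂.2 (hsplit h₃) h₁.1 h₁.2.1 h₁.2.2 d hdD).mono hwf hd (hdle.trans ?_)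
    rw [hsum, hv.eval_eq h₂.1 h₂.2]
    gcongr
  | lo =>
    set X := weightedSum D.1 θ₂ with hX
    set X' : Term Sg (SVar Sg) := .bin .mul (.num (-1)) X with hX'
    have hvars : X'.vars = X.vars := by simp [hX', Term.vars]
    refine ⟨_, measure_exceeds_tail_le _
      (fun η => X'.eval (constInterp I.const) (noisyVal W η)) _, ?_⟩
    intro η hη pt v hW hv r hr
    simp only [ShieldSpec.evalInst, tailInst] at hr
    split_ifs at hr with h₁ h₂ h₃ <;> try simp at hr
    obtain ⟨b, hb, rfl⟩ := hr
    have hXs := hnoise h₃ hvars.subset hv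
    have hle : -X.eval I (modelVal spec I φs pt η) ≤ b := by
      have h := hv.tail_eval_eq hW h₃ hXs
      have h' : X'.eval I (modelVal spec I φs pt η) = -X.eval I (modelVal spec I φs pt η) := by
        simp [hX', Term.eval, ArithOp.eval]
      rw [← h', ← h]
      by_contra! hlt
      exact hη ⟨b, htail.stateNoiseLaw_le hwf (hWv hW hv) h₃ hXs hb, hlt⟩
    obtain ⟨d, hdD, hdle⟩ := exists_weighted_sum_le D fun j =>
      (Term.bin .add θ₁ θ₂).eval I (modelVal spec I φs pt η ∘ inst j)
    refine (hinst hv h₂.2 (fun y hy => hsplit h₃ y (hvars ▸ hy)) h₁.1 h₁.2.1 h₁.2.2 d hdD).anti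
      hwf hd (le_trans ?_ hdle)
    rw [hsum, hv.eval_eq h₂.1 h₂.2]
    linarith

lemma soundInst_of_mem_iexpr_sem (hwf : spec.WellFormed) (hA : ∀ w, spec.Assum I w)
    {tail : TailFun Sg} (htail : spec.IsInvCCDF tail) (W : Option ℕ → DLVar Sg → ℝ) {p : Sg.Param}
    {e : IExpr Sg} (hob : spec.inferObligation p e) (he : e.WellFormed) (act : e.Act)
    {a : SBInst Sg × unitInterval} (ha : a ∈ e.sem (spec.dir p) act) :
    SoundInst spec I φs tail W (p, a.1, a.2) := by
  cases e with
  | direct θ G =>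
    obtain rfl := List.mem_singleton.1 ha
    exact ⟨∅, by simp, fun η _ pt v _ hv r hr => hv.boundHolds_guard_term hwf hA tail hob _ hr⟩
  | best n θ G =>
    obtain ⟨j, -, rfl⟩ := List.mem_map.1 ha
    exact ⟨∅, by simp, fun η _ pt v _ hv r hr => hv.boundHolds_guard_term hwf hA tail hob _ hr⟩
  | aggregate n θ₁ θ₂ G =>
    obtain ⟨ε, D⟩ := act
    obtain rfl := List.mem_singleton.1 ha
    exact soundInst_aggregate hwf hA htail W hob he ε D

lemma soundInst_of_mem_sem (hwf : spec.WellFormed) (hob : spec.Obligations)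
    (hA : ∀ w, spec.Assum I w) {tail : TailFun Sg} (htail : spec.IsInvCCDF tail)
    (W : Option ℕ → DLVar Sg → ℝ) (act : spec.infer.Act) :
    ∀ a ∈ spec.infer.sem spec.dir act, SoundInst spec I φs tail W a := by
  intro a ha
  simp only [Strategy.sem, List.mem_flatMap, List.mem_map] at ha
  obtain ⟨k, -, e, he, rfl⟩ := ha
  have hmem : spec.infer.get k ∈ spec.infer := List.get_mem _ _
  exact soundInst_of_mem_iexpr_sem hwf hA htail W (hob.infer_sound _ hmem)
    (hwf.infer_wf _ hmem) (act k) he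

/-! ### Executing a list of assignments -/

/-- The index assignment in which the current state, with index `n` or none, is `s` with parameter
values `b`, and the other indices are given by `hp`. -/
def currentPt (hp : ℕ → Option (S × (Sg.Param → ℝ))) (n : ℕ) (s : S) (b : Sg.Param → ℝ) :
    Option ℕ → Option (S × (Sg.Param → ℝ))
  | none => some (s, b)
  | some i => if i = n then some (s, b) else hp i

lemma join_congr {s : Sg.StateVar → ℝ} {b b' : Sg.Param → ℝ} {P : Formula Sg (DLVar Sg)}
    {T : Set Sg.Param} (hP : P.FreeIn (Set.range DLVar.state ∪ DLVar.param '' T))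
    (h : ∀ p ∈ T, b p = b' p) (hs : P.sem I (join s b)) : P.sem I (join s b') := by
  refine (hP I _ _ ?_).1 hs
  rintro _ (⟨x, rfl⟩ | ⟨p, hp, rfl⟩)
  · rfl
  · exact h p hp

variable (spec) in
/-- The invariant of the execution of symbolic inference assignments. -/
def InferInv (I : Interp Sg) (φs : S → Sg.StateVar → ℝ) (hp : ℕ → Option (S × (Sg.Param → ℝ)))
    (n : ℕ) (s : S) (η : Option ℕ → Sg.NoiseVar → ℝ) (v : PVal Sg) : Prop :=
  ∃ b, Consistent spec I φs (currentPt hp n s b) η v ∧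
    ∀ p, spec.IsGlobal p → (v (.param p, none)).isSome

open Classical in
-- The witness `b` moves to the new value of `p`, which changes the point at both indices of the
-- current state. Bounds of other parameters do not read `p`; the invariant reads `p` only if `p` is
-- global.
lemma InferInv.update (hwf : spec.WellFormed) (hob : spec.Obligations)
    (hA : ∀ w, spec.Assum I w) {hp : ℕ → Option (S × (Sg.Param → ℝ))} {n : ℕ} {s : S}
    {b : Sg.Param → ℝ} (hv : Consistent spec I φs (currentPt hp n s b) η v)
    (hglob : ∀ p, spec.IsGlobal p → (v (.param p, none)).isSome) {p : Sg.Param} {r : ℝ}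
    (hb : BoundHolds spec I φs (currentPt hp n s b) η p r)
    (ht : ∀ r' ∈ v (.param p, none), (spec.dir p).tighter r r') :
    InferInv spec I φs hp n s η
      (Function.update (Function.update v (.param p, none) (some r)) (.param p, some n)
        (some r)) := by
  set b' := Function.update b p r with hb'
  set v' := Function.update (Function.update v (.param p, none) (some r)) (.param p, some n)
    (some r) with hv'
  have hvals : ∀ x : SVar Sg, (x = (.param p, none) ∨ x = (.param p, some n)) ∧ v' x = some r ∨
      (x ≠ (.param p, none) ∧ x ≠ (.param p, some n)) ∧ v' x = v x := by
    intro x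
    by_cases h₁ : x = (.param p, some n)
    · exact .inl ⟨.inr h₁, by simp [hv', h₁]⟩
    by_cases h₂ : x = (.param p, none)
    · exact .inl ⟨.inl h₂, by simp [hv', h₂]⟩
    · exact .inr ⟨⟨h₂, h₁⟩, by simp [hv', h₁, h₂]⟩
  have hpt : ∀ i, (currentPt hp n s b i = some (s, b) ∧ currentPt hp n s b' i = some (s, b') ∧
      (i = none ∨ i = some n)) ∨
      (currentPt hp n s b' i = currentPt hp n s b i ∧ i ≠ none ∧ i ≠ some n) := by
    rintro (_ | i)
    · exact .inl ⟨rfl, rfl, .inl rfl⟩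
    · by_cases hi : i = n
      · exact .inl (by simp [currentPt, hi])
      · exact .inr (by simp [currentPt, hi])
  have hbp : (spec.bound p).sem I (join (φs s) b') := by
    refine (hwf.bound_free p I _ _ ?_).1 hb
    rintro _ (⟨z, rfl⟩ | rfl)
    · simp [modelVal, currentPt, join]
    · simp [join, hb']
  have hinv0 : spec.inv.sem I (join (φs s) b) := hv.inv none (s, b) rfl
  have hinv : spec.inv.sem I (join (φs s) b') := by
    by_cases hg : spec.IsGlobal p
    -- A global parameter already has a value, so the update is a strict tightening and
    -- `inv_monotone` applies.
    · obtain ⟨r', hr'⟩ := Option.isSome_iff_exists.1 (hglob p hg)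
      have hbr : b p = r' := by simpa [modelVal, currentPt] using hv.agree _ _ hr'
      have h₁ : Function.update (join (φs s) b) (.param p) r' = join (φs s) b := by
        rw [Function.update_eq_self_iff]; exact hbr.symm
      have h₂ : Function.update (join (φs s) b) (.param p) r = join (φs s) b' := by
        funext x
        cases x with
        | param q =>
          by_cases hq : q = p
          · subst hq; simp [join, hb']
          · simp [join, hb', hq]
        | _ => simp [join]
      rw [← h₂]
      exact hob.inv_monotone I _ p r r' (hA _) (ht r' hr') (by rw [h₁]; exact hinv0)
    · refine join_congr hwf.inv_free (fun q hq => ?_) hinv0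
      have hne : q ≠ p := fun h => hg (h ▸ hq)
      simp [hb', hne]
  refine ⟨b', ⟨?_, ?_, ?_, ?_⟩, ?_⟩
  · rintro ⟨y, i⟩ r₀ hr₀
    rcases hvals (y, i) with ⟨h, hsome⟩ | ⟨⟨h₁, h₂⟩, hsame⟩
    · obtain rfl : r = r₀ := Option.some.inj (hsome.symm.trans hr₀)
      rcases h with h | h <;> obtain ⟨rfl, rfl⟩ := Prod.mk.inj h <;> simp [modelVal, currentPt, hb']
    · rw [← hv.agree (y, i) r₀ (hsame ▸ hr₀)]
      rcases hpt i with ⟨e₁, e₂, hi⟩ | ⟨e, -, -⟩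
      · cases y with
        | param q =>
          have hq : q ≠ p := by
            rintro rfl
            rcases hi with rfl | rfl
            exacts [h₁ rfl, h₂ rfl]
          simp only [modelVal, e₁, e₂, Option.elim_some]
          simp [hb', hq]
        | _ => simp [modelVal, e₁, e₂]
      · cases y <;> simp [modelVal, e]
  · intro y i r₀ hr₀
    have hex : ∃ q, currentPt hp n s b i = some q → ∃ q, currentPt hp n s b' i = some q := by
      rcases hpt i with ⟨-, e₂, -⟩ | ⟨e, -, -⟩
      · exact ⟨(s, b), fun _ => ⟨_, e₂⟩⟩
      · exact ⟨(s, b), fun h => ⟨_, e.trans h⟩⟩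
    rcases hvals (y, i) with ⟨h, hsome⟩ | ⟨⟨h₁, h₂⟩, hsame⟩
    · rcases h with h | h <;> obtain ⟨rfl, rfl⟩ := Prod.mk.inj h
      · exact ⟨⟨_, rfl⟩, .inr (.inl ⟨p, rfl⟩)⟩
      · exact ⟨⟨(s, b'), by simp [currentPt]⟩, .inr (.inl ⟨p, rfl⟩)⟩
    · obtain ⟨⟨q, hq⟩, hy⟩ := hv.located y i r₀ (hsame ▸ hr₀)
      refine ⟨?_, hy⟩
      rcases hpt i with ⟨-, e₂, -⟩ | ⟨e, -, -⟩
      · exact ⟨_, e₂⟩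
      · exact ⟨_, e.trans hq⟩
  · intro i q hq
    rcases hpt i with ⟨-, e₂, -⟩ | ⟨e, -, -⟩
    · obtain rfl := Option.some.inj (e₂.symm.trans hq)
      exact hinv
    · exact hv.inv i q (e ▸ hq)
  · intro p' i r₀ q hr₀ hq
    rcases hpt i with ⟨e₁, e₂, hi⟩ | ⟨e, hi₁, hi₂⟩
    · obtain rfl := Option.some.inj (e₂.symm.trans hq)
      by_cases hpp : p' = p
      · subst hpp; exact hbp
      · rcases hvals (.param p', i) with ⟨h, -⟩ | ⟨-, hsame⟩
        · simp [hpp] at h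
        · refine join_congr (b := b) (T := {p'}) (by simpa using hwf.bound_free p') ?_
            (hv.bound p' i r₀ (s, b) (hsame ▸ hr₀) e₁)
          rintro _ rfl
          simp [hb', hpp]
    · rcases hvals (.param p', i) with ⟨h, -⟩ | ⟨-, hsame⟩
      · simp [hi₁, hi₂] at h
      · exact hv.bound p' i r₀ q (hsame ▸ hr₀) (e ▸ hq)
  · intro q hq
    rcases hvals (.param q, none) with ⟨-, h⟩ | ⟨-, h⟩ <;> rw [h]
    · rfl
    · exact hglob q hq

/-- The charge depends only on the tolerance and the remaining budget, not on evaluation. Hence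
which assignments get skipped does not depend on the measurements. -/
lemma stepAssign_snd (tail : TailFun Sg) (c : Sg.Const → ℝ) (n : ℕ) (v v' : PVal Sg)
    (rem : unitInterval) (a : Sg.Param × SBInst Sg × unitInterval) :
    (stepAssign spec tail c n (v, rem) a).2 = (stepAssign spec tail c n (v', rem) a).2 := by
  have : ∀ w : PVal Sg, (stepAssign spec tail c n (w, rem) a).2 =
      if h : a.2.2 ≤ rem then ⟨(rem : ℝ) - (a.2.2 : ℝ), sub_nonneg.2 h,
        (sub_le_self _ a.2.2.2.1).trans rem.2.2⟩ else rem := by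
    intro w
    simp only [stepAssign]
    split_ifs
    · split
      · rfl
      · split_ifs <;> rfl
    · rfl
  rw [this, this]

lemma stepAssign_isSome (tail : TailFun Sg) (c : Sg.Const → ℝ) (n : ℕ) (σ : PVal Sg × unitInterval)
    (a : Sg.Param × SBInst Sg × unitInterval) {x : SVar Sg} (hx : (σ.1 x).isSome) :
    ((stepAssign spec tail c n σ a).1 x).isSome := by
  classical
  simp only [stepAssign]
  split_ifs
  · split
    · exact hx
    · split_ifs
      · simp only [Function.update_apply]
        split_ifs <;> first | rfl | exact hx
      · exact hx
  · exact hx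

lemma foldl_stepAssign_isSome (tail : TailFun Sg) (c : Sg.Const → ℝ) (n : ℕ)
    (B : List (Sg.Param × SBInst Sg × unitInterval)) (σ : PVal Sg × unitInterval) {x : SVar Sg}
    (hx : (σ.1 x).isSome) : ((B.foldl (stepAssign spec tail c n) σ).1 x).isSome := by
  induction B generalizing σ with
  | nil => exact hx
  | cons a B ih => exact ih _ (stepAssign_isSome tail c n σ a hx)

/-- An assignment without cost that can be evaluated as soon as the variables in `V` are defined
gives a value to its parameter. -/
lemma foldl_stepAssign_isSome_of_mem (tail : TailFun Sg) (c : Sg.Const → ℝ) (n : ℕ)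
    (B : List (Sg.Param × SBInst Sg × unitInterval)) (σ : PVal Sg × unitInterval)
    {a : Sg.Param × SBInst Sg × unitInterval} (ha : a ∈ B) (ha₀ : a.2.2 = 0)
    {V : Set (SVar Sg)}
    (heval : ∀ v : PVal Sg, v.DefinedOn V → (spec.evalInst tail c v a.2.1).isSome)
    (hσ : σ.1.DefinedOn V) :
    ((B.foldl (stepAssign spec tail c n) σ).1 (.param a.1, none)).isSome := by
  induction B generalizing σ with
  | nil => simp at ha
  | cons a' B ih =>
    rcases List.mem_cons.1 ha with rfl | ha
    · refine foldl_stepAssign_isSome tail c n B _ ?_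
      obtain ⟨r, hr⟩ := Option.isSome_iff_exists.1 (heval _ hσ)
      simp only [stepAssign, hr]
      -- A cost of zero fits any remaining budget.
      rw [dif_pos (ha₀ ▸ σ.2.2.1)]
      split_ifs with h
      · simp only [Function.update_apply]
        simp
      -- A value can only be rejected in favour of one already present.
      · push Not at h
        obtain ⟨r', hr', -⟩ := h
        exact Option.isSome_iff_exists.2 ⟨r', hr'⟩
    · exact ih _ ha fun x hx => stepAssign_isSome tail c n σ a' (hσ x hx)

lemma InferInv.stepAssign (hwf : spec.WellFormed) (hob : spec.Obligations)
    (hA : ∀ w, spec.Assum I w) {tail : TailFun Sg} {hp : ℕ → Option (S × (Sg.Param → ℝ))} {n : ℕ}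
    {s : S} {a : Sg.Param × SBInst Sg × unitInterval} {σ : PVal Sg × unitInterval}
    (hσ : InferInv spec I φs hp n s η σ.1)
    (ha : ∀ b, Consistent spec I φs (currentPt hp n s b) η σ.1 → a.2.2 ≤ σ.2 →
      ∀ r, spec.evalInst tail I.const σ.1 a.2.1 = some r →
      BoundHolds spec I φs (currentPt hp n s b) η a.1 r) :
    InferInv spec I φs hp n s η (stepAssign spec tail I.const n σ a).1 := by
  obtain ⟨b, hv, hglob⟩ := hσ
  simp only [AdaptiveShield.stepAssign]
  split_ifs with hε
  · split
    · exact ⟨b, hv, hglob⟩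
    · next r hr =>
      split_ifs with ht
      · convert InferInv.update hwf hob hA hv hglob (ha b hv hε r hr) ht
      · exact ⟨b, hv, hglob⟩
  · exact ⟨b, hv, hglob⟩

/-- Executing sound assignments preserves the invariant outside of an event whose probability is at
most the budget that is spent. -/
lemma exists_event_foldl_stepAssign (hwf : spec.WellFormed) (hob : spec.Obligations)
    (hA : ∀ w, spec.Assum I w) {tail : TailFun Sg} {W : Option ℕ → DLVar Sg → ℝ}
    {hp : ℕ → Option (S × (Sg.Param → ℝ))} {n : ℕ} {s : S}
    (hW : ∀ b i q, currentPt hp n s b i = some q → ∀ x, W i (.state x) = φs q.1 x)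
    (B : List (Sg.Param × SBInst Sg × unitInterval)) (hB : ∀ a ∈ B, SoundInst spec I φs tail W a)
    (rem : unitInterval) :
    ∃ (E : Set (Option ℕ → Sg.NoiseVar → ℝ)) (rem' : unitInterval),
      spec.stateNoiseLaw I.const W E + ENNReal.ofReal (rem' : ℝ) ≤ ENNReal.ofReal (rem : ℝ) ∧
      (∀ v, (B.foldl (stepAssign spec tail I.const n) (v, rem)).2 = rem') ∧
      ∀ η ∉ E, ∀ v, InferInv spec I φs hp n s η v →
        InferInv spec I φs hp n s η (B.foldl (stepAssign spec tail I.const n) (v, rem)).1 := by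
  induction B generalizing rem with
  | nil => exact ⟨∅, rem, by simp, fun v => rfl, fun η _ v hv => hv⟩
  | cons a B ih =>
    obtain ⟨E₁, hE₁, hsound⟩ := hB a List.mem_cons_self
    have hB' : ∀ a ∈ B, SoundInst spec I φs tail W a := fun a ha => hB a (List.mem_cons_of_mem _ ha)
    -- The empty valuation is a representative: every valuation leaves the same budget.
    set rem₁ := (stepAssign spec tail I.const n (fun _ => none, rem) a).2 with hrem₁
    obtain ⟨E₂, rem', hE₂, hr', hinv⟩ := ih hB' rem₁
    have hstep : ∀ v, stepAssign spec tail I.const n (v, rem) a =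
        ((stepAssign spec tail I.const n (v, rem) a).1, rem₁) := fun v =>
      Prod.ext rfl (stepAssign_snd tail I.const n v _ rem a)
    by_cases hε : a.2.2 ≤ rem
    · have hrem : (rem₁ : ℝ) = rem - a.2.2 := by
        simp only [hrem₁, AdaptiveShield.stepAssign]
        rw [dif_pos hε]
        split
        · rfl
        · split_ifs <;> rfl
      refine ⟨E₁ ∪ E₂, rem', ?_, fun v => ?_, fun η hη v hv => ?_⟩
      -- Union bound: the first event is paid for by the tolerance of `a`, the second by what is
      -- spent from `rem₁`.
      · calc spec.stateNoiseLaw I.const W (E₁ ∪ E₂) + ENNReal.ofReal (rem' : ℝ)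
            ≤ spec.stateNoiseLaw I.const W E₁ +
              (spec.stateNoiseLaw I.const W E₂ + ENNReal.ofReal (rem' : ℝ)) := by
              rw [← add_assoc]; gcongr; exact measure_union_le _ _
          _ ≤ ENNReal.ofReal (a.2.2 : ℝ) + ENNReal.ofReal (rem₁ : ℝ) := by gcongr
          _ = ENNReal.ofReal (rem : ℝ) := by
              rw [← ENNReal.ofReal_add a.2.2.2.1 rem₁.2.1, hrem]; congr 1; ring
      · rw [List.foldl_cons, hstep, hr']
      · rw [List.foldl_cons, hstep]
        refine hinv η (fun h => hη (.inr h)) _ ?_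
        exact InferInv.stepAssign hwf hob hA hv fun b hb _ r hr =>
          hsound η (fun h => hη (.inl h)) _ v (hW b) hb r hr
    · have hrem : rem₁ = rem := by
        simp only [hrem₁, AdaptiveShield.stepAssign]
        rw [dif_neg hε]
      refine ⟨E₂, rem', hrem ▸ hE₂, fun v => ?_, fun η hη v hv => ?_⟩
      · rw [List.foldl_cons, hstep, hr']
      · rw [List.foldl_cons, hstep]
        refine hinv η hη _ ?_
        exact InferInv.stepAssign hwf hob hA hv fun b hb h => absurd h hε

/-- The parameter values obtained by inference satisfy the bounds and the invariant. -/
lemma InferInv.bound_and_inv {hp : ℕ → Option (S × (Sg.Param → ℝ))} {n : ℕ} {s : S}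
    (hv : InferInv spec I φs hp n s η v)
    (hsome : ∀ p, (v (.param p, none)).isSome) :
    spec.Bound I (join (φs s) fun p => v.total (.param p, none)) ∧
      spec.inv.sem I (join (φs s) fun p => v.total (.param p, none)) := by
  obtain ⟨b, hb, -⟩ := hv
  -- With every parameter set, the default 0 of `total` is never used and the witness is the
  -- recorded valuation.
  have : (fun p => v.total (.param p, none)) = b := by
    funext p
    obtain ⟨r, hr⟩ := Option.isSome_iff_exists.1 (hsome p)
    rw [PVal.total, hr, Option.getD_some]
    simpa [modelVal, currentPt] using (hb.agree _ _ hr).symm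
  rw [this]
  refine ⟨fun p => ?_, hb.inv none (s, b) rfl⟩
  obtain ⟨r, hr⟩ := Option.isSome_iff_exists.1 (hsome p)
  exact hb.bound p none r (s, b) hr rfl

end Inference

/-! ## One transition of the shielded environment -/

section OneStep

variable {Sg : Signature} {spec : ShieldSpec Sg} {S A : Type*} [MeasurableSpace S]
  [MeasurableSpace A]

/-- The true interpretation of all symbols. -/
def CompatibleEnv.interp (env : CompatibleEnv spec S A) : Interp Sg := ⟨env.c, env.u⟩

/-- The global bounds and the invariant hold in the current state, and all bounds and the invariant
held in the recorded states, for some values of the global parameters. -/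
structure CompatibleEnv.GoodState (env : CompatibleEnv spec S A) (x : ShState spec S) : Prop where
  gbound : spec.GBound env.interp (join (env.φs x.1) (spec.joinParams x.2.2.1 0))
  inv : spec.inv.sem env.interp (join (env.φs x.1) (spec.joinParams x.2.2.1 0))
  -- The history stores only local parameters, but the invariant at a past index also reads the
  -- global values of that time, hence the existential.
  hist : ∀ e ∈ x.2.1, ∃ bG, spec.Bound env.interp (join (env.φs e.1) (spec.joinParams bG e.2.2)) ∧
    spec.inv.sem env.interp (join (env.φs e.1) (spec.joinParams bG e.2.2))

lemma joinParams_of_isGlobal {bG : spec.GParam → ℝ} {bL : spec.LParam → ℝ} {p : Sg.Param}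
    (h : spec.IsGlobal p) : spec.joinParams bG bL p = bG ⟨p, h⟩ := by
  simp [ShieldSpec.joinParams, h]

lemma joinParams_of_not_isGlobal {bG : spec.GParam → ℝ} {bL : spec.LParam → ℝ} {p : Sg.Param}
    (h : ¬ spec.IsGlobal p) : spec.joinParams bG bL p = bL ⟨p, h⟩ := by
  simp [ShieldSpec.joinParams, h]

lemma joinParams_restrict (b : Sg.Param → ℝ) :
    spec.joinParams (fun p => b p.1) (fun p => b p.1) = b := by
  funext p
  by_cases h : spec.IsGlobal p
  · rw [joinParams_of_isGlobal h]
  · rw [joinParams_of_not_isGlobal h]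

/-- The control action chosen by the filter preserves the invariant. -/
lemma CompatibleEnv.ae_inv_filterAction (hwf : spec.WellFormed) (hob : spec.Obligations)
    (env : CompatibleEnv spec S A) (hA : ∀ w, spec.Assum env.interp w)
    {fallback : (Sg.Param → ℝ) → (Sg.StateVar → ℝ) → spec.ctrl.Act}
    (hfallback : spec.IsFallback env.c fallback) (s : S) (a : A) (b : Sg.Param → ℝ)
    (hbound : spec.Bound env.interp (join (env.φs s) b))
    (hinv : spec.inv.sem env.interp (join (env.φs s) b)) :
    ∀ᵐ s' ∂env.mdp.P (s, env.filterAction fallback s a b),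
      spec.inv.sem env.interp (join (env.φs s') b) := by
  have hconst : (constInterp env.c).const = env.interp.const := rfl
  have hmon : spec.ctrl.monitor (constInterp env.c) (join (env.φs s) b)
      (env.φa (env.filterAction fallback s a b)) := by
    unfold CompatibleEnv.filterAction
    split_ifs with h
    · exact h
    · rw [env.φa_inv]
      refine hfallback b (env.φs s) ?_
      -- Some run of the controller exists, so the monitor permits some action and therefore the
      -- fallback.
      obtain ⟨t, ht, -⟩ := hob.ctrl_total env.interp _ (hA _) hbound hinv
      obtain ⟨a', ha', -⟩ := Ctrl.exists_monitor_of_sem _ _ _ _ ht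
      exact ⟨a', (Ctrl.monitor_interp_congr hconst _ hwf.ctrl_wf _ _).2 ha'⟩
  have hsem : spec.ctrl.toProgram.sem env.interp (join (env.φs s) b)
      (spec.ctrl.exec (constInterp env.c) (join (env.φs s) b)
        (env.φa (env.filterAction fallback s a b))) := by
    rw [Ctrl.exec_interp_congr hconst _ hwf.ctrl_wf]
    exact Ctrl.sem_exec_of_monitor _ _ _ _
      ((Ctrl.monitor_interp_congr hconst _ hwf.ctrl_wf _ _).1 hmon)
  filter_upwards [env.model_correct s _ b (hA _) hbound hinv hsem] with s' hs'
  exact hob.inv_preserved env.interp _ (hA _) hbound hinv _ ⟨_, hsem, hs'⟩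

/-- The measurement of the observation variables in the recorded states, as a function of the
noise. -/
def CompatibleEnv.measurement (env : CompatibleEnv spec S A) (h : Hist spec S)
    (η : Option ℕ → Sg.NoiseVar → ℝ) : Fin h.length → Sg.ObsVar → ℝ :=
  fun k ω => (spec.obs ω).eval env.interp (joinNoise (env.φs (h.get k).1) (η (some (k + 1))))

/-- Observation terms may contain unknowns. Still, the pushforward is a probability measure, whereas
it would be 0 for a map that is not a.e. measurable. -/
lemma CompatibleEnv.aemeasurable_obs (env : CompatibleEnv spec S A) (s : S) :
    AEMeasurable (fun (η : Sg.NoiseVar → ℝ) (ω : Sg.ObsVar) =>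
      (spec.obs ω).eval env.interp (joinNoise (env.φs s) η))
      (spec.noiseLaw env.c (join (env.φs s) 0)) := by
  by_contra h
  have h₁ := env.obs_correct s
  have h₂ := env.μ_prob s
  rw [← h₁] at h₂
  exact h (AEMeasurable.of_map_ne_zero h₂.ne_zero)

/-- The coupling: independent observations at the recorded states are images of disjoint coordinates
of one noise family. List position `k` carries index `k + 1`. -/
lemma CompatibleEnv.aemeasurable_measurement_and_map (env : CompatibleEnv spec S A)
    (h : Hist spec S) (W : Option ℕ → DLVar Sg → ℝ)
    (hW : ∀ k : Fin h.length, W (some (k + 1)) = join (env.φs (h.get k).1) 0) :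
    AEMeasurable (env.measurement h) (spec.stateNoiseLaw env.c W) ∧
      (spec.stateNoiseLaw env.c W).map (env.measurement h)
        = Measure.pi fun k => env.μ (h.get k).1 := by
  let e : Fin h.length ↪ Option ℕ := ⟨fun k => some (k + 1), fun k l hkl => by
    simpa [Fin.ext_iff] using hkl⟩
  let F : (k : Fin h.length) → (Sg.NoiseVar → ℝ) → Sg.ObsVar → ℝ := fun k η ω =>
    (spec.obs ω).eval env.interp (joinNoise (env.φs (h.get k).1) η)
  have hF : ∀ k, AEMeasurable (F k) (spec.noiseLaw env.c (W (e k))) := fun k => by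
    have := env.aemeasurable_obs (h.get k).1
    rwa [← hW k] at this
  have hmap : (spec.stateNoiseLaw env.c W).map (fun η k => η (e k))
      = Measure.pi fun k => spec.noiseLaw env.c (W (e k)) :=
    infinitePi_map_embedding _ e
  have hFpi : AEMeasurable (fun (z : Fin h.length → Sg.NoiseVar → ℝ) k => F k (z k))
      (Measure.pi fun k => spec.noiseLaw env.c (W (e k))) :=
    aemeasurable_pi_lambda _ fun k =>
      (hF k).comp_quasiMeasurePreserving (Measure.quasiMeasurePreserving_eval _ k)
  have hproj : Measurable fun (η : Option ℕ → Sg.NoiseVar → ℝ) (k : Fin h.length) => η (e k) := by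
    fun_prop
  have hcomp : env.measurement h = (fun z k => F k (z k)) ∘ fun η k => η (e k) := rfl
  have hμ : ∀ k, (spec.noiseLaw env.c (W (e k))).map (F k) = env.μ (h.get k).1 := fun k => by
    rw [← env.obs_correct, ← hW k]
    rfl
  refine ⟨?_, ?_⟩
  · rw [hcomp]
    exact AEMeasurable.comp_measurable (hmap ▸ hFpi) hproj
  · have hprob := fun k => env.μ_prob (h.get k).1
    have : ∀ k, IsProbabilityMeasure ((spec.noiseLaw env.c (W (e k))).map (F k)) := fun k => by
      rw [hμ]; infer_instance
    rw [hcomp, ← AEMeasurable.map_map_of_aemeasurable (hmap ▸ hFpi) hproj.aemeasurable, hmap,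
      Measure.pi_map_pi hF]
    simp only [hμ]

/-- The recorded state and parameters at each history index, global parameters being given
by `bH`. -/
def histPt (h : Hist spec S) (bH : Fin h.length → spec.GParam → ℝ) (i : ℕ) :
    Option (S × (Sg.Param → ℝ)) :=
  if hi : 1 ≤ i ∧ i ≤ h.length then
    some ((h.get ⟨i - 1, by omega⟩).1,
      spec.joinParams (bH ⟨i - 1, by omega⟩) (h.get ⟨i - 1, by omega⟩).2.2)
  else none

/-- The witness gives local parameters of the current state the value 0. They are not yet recorded,
so no bound is claimed for them, and the invariant does not read them. -/
lemma CompatibleEnv.inferInv_loadVal (env : CompatibleEnv spec S A)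
    {x : ShState spec S} (hx : env.GoodState x) {bH : Fin x.2.1.length → spec.GParam → ℝ}
    (hbH : ∀ k, spec.Bound env.interp
        (join (env.φs (x.2.1.get k).1) (spec.joinParams (bH k) (x.2.1.get k).2.2)) ∧
      spec.inv.sem env.interp
        (join (env.φs (x.2.1.get k).1) (spec.joinParams (bH k) (x.2.1.get k).2.2)))
    (Ω : Set (Sg.ObsVar × ℕ)) (η : Option ℕ → Sg.NoiseVar → ℝ) :
    InferInv spec env.interp env.φs (histPt x.2.1 bH) (x.2.1.length + 1) x.1 η
      (loadVal spec env.φs x.1 x.2.1 x.2.2.1 Ω (env.measurement x.2.1 η)) := by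
  classical
  obtain ⟨s, h, bG, rem⟩ := x
  dsimp only at *
  set b := spec.joinParams bG 0 with hb
  set v := loadVal spec env.φs s h bG Ω (env.measurement h η) with hv
  -- Every loaded entry comes either from the current state or from one history element.
  have hcases : ∀ y i r, v (y, i) = some r →
      (currentPt (histPt h bH) (h.length + 1) s b i = some (s, b) ∧
        currentVal spec env.φs s bG y = some r) ∨
      ∃ k : Fin h.length, i = some ((k : ℕ) + 1) ∧ currentPt (histPt h bH) (h.length + 1) s b i
        = some ((h.get k).1, spec.joinParams (bH k) (h.get k).2.2) ∧
        historyVal spec env.φs Ω (k + 1) (h.get k) (env.measurement h η k) y = some r := by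
    rintro y (_ | i) r hr
    · exact .inl ⟨rfl, hr⟩
    · simp only [hv, loadVal] at hr
      split_ifs at hr with h₁ h₂
      · exact .inl ⟨by simp [currentPt, h₁], hr⟩
      · obtain ⟨k, rfl⟩ : ∃ k, i = k + 1 := ⟨i - 1, by omega⟩
        refine .inr ⟨⟨k, by omega⟩, rfl, ?_, hr⟩
        have hk : k < h.length := by omega
        have hk' : k ≠ h.length := by omega
        simp [currentPt, histPt, hk, hk']
  refine ⟨b, ⟨?_, ?_, ?_, ?_⟩, ?_⟩
  · rintro ⟨y, i⟩ r hr
    rcases hcases y i r hr with ⟨hpt, hval⟩ | ⟨k, hi, hpt, hval⟩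
    · cases y <;> simp only [currentVal, reduceCtorEq] at hval
      · simpa [modelVal, hpt] using hval
      · split_ifs at hval with hg
        simp only [modelVal, hpt, Option.elim_some]
        rw [hb, joinParams_of_isGlobal hg]
        exact Option.some.inj hval
    · cases y <;> simp only [historyVal, reduceCtorEq] at hval
      · simpa [modelVal, hpt] using hval
      · split_ifs at hval with hg
        simpa [modelVal, hpt, joinParams_of_not_isGlobal hg] using hval
      · split_ifs at hval with hΩ
        subst hi
        simpa only [modelVal, hpt, Option.elim_some, CompatibleEnv.measurement,
          Option.some.injEq] using hval
  · intro y i r hr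
    rcases hcases y i r hr with ⟨hpt, hval⟩ | ⟨k, -, hpt, hval⟩
    · refine ⟨⟨_, hpt⟩, ?_⟩
      cases y <;> simp_all [currentVal]
    · refine ⟨⟨_, hpt⟩, ?_⟩
      cases y <;> simp_all [historyVal]
  · rintro (_ | i) q hq
    · obtain rfl := Option.some.inj hq
      exact hx.inv
    · simp only [currentPt, histPt] at hq
      split_ifs at hq
      · obtain rfl := Option.some.inj hq
        exact hx.inv
      · obtain rfl := Option.some.inj hq
        exact (hbH _).2
  · intro p i r q hr hq
    rcases hcases (.param p) i r hr with ⟨hpt, hval⟩ | ⟨k, -, hpt, hval⟩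
    · obtain rfl := Option.some.inj (hpt.symm.trans hq)
      simp only [currentVal] at hval
      split_ifs at hval with hg
      exact hx.gbound p hg
    · obtain rfl := Option.some.inj (hpt.symm.trans hq)
      exact (hbH k).1 p
  · intro p hg
    simp [hv, loadVal, currentVal, hg]

/-- Global parameters are loaded at the start. A local one has a free, unguarded default reading
only state variables and global parameters, so that assignment cannot fail. -/
lemma CompatibleEnv.inferResult_isSome (hwf : spec.WellFormed) (env : CompatibleEnv spec S A)
    (tail : TailFun Sg) (x : ShState spec S) (a : spec.infer.Act)
    (o : Fin x.2.1.length → Sg.ObsVar → ℝ) (p : Sg.Param) :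
    ((env.inferResult tail x a o).1 (.param p, none)).isSome := by
  unfold CompatibleEnv.inferResult
  by_cases hg : spec.IsGlobal p
  · exact foldl_stepAssign_isSome _ _ _ _ _ (by simp [loadVal, currentVal, hg])
  obtain ⟨θ, hmem, hθ, hvars⟩ := hwf.infer_defaults p hg
  obtain ⟨k, hk⟩ := List.get_of_mem hmem
  let d : Sg.Param × SBInst Sg × unitInterval :=
    (p, .guard (.term (θ.rename (inst Fin.elim0))) (QF.tt.rename (inst (Sg := Sg) Fin.elim0)), 0)
  have hsem : ∀ (pe : Sg.Param × IExpr Sg) (act : pe.2.Act), pe = (p, IExpr.direct θ .tt) →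
      d ∈ (pe.2.sem (spec.dir pe.1) act).map fun e => (pe.1, e.1, e.2) := by
    rintro _ act rfl
    exact List.mem_map.2 ⟨_, List.mem_singleton.2 rfl, rfl⟩
  have hd : d ∈ spec.infer.sem spec.dir a :=
    List.mem_flatMap.2 ⟨k, List.mem_finRange k, hsem _ (a k) hk⟩
  refine foldl_stepAssign_isSome_of_mem tail env.c _ _ _ hd rfl
    (V := (θ.rename (inst Fin.elim0)).vars) (fun v hv => ?_) ?_
  · simp only [d, ShieldSpec.evalInst]
    rw [if_pos, if_pos]
    · rfl
    · exact ⟨hθ.rename, hv⟩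
    · refine ⟨trivial, fun x hx => ?_, ?_⟩
      · simp [QF.rename, QF.vars] at hx
      · simp [QF.rename, QF.toFormula, Formula.tt, Formula.sem, CmpOp.holds]
  · intro y hy
    rw [Term.vars_rename] at hy
    obtain ⟨⟨z, i⟩, hz, rfl⟩ := hy
    cases i with
    | some i => exact i.elim0
    | none =>
      rcases hvars _ hz with ⟨w, hw⟩ | ⟨q, hq, hw⟩ <;> dsimp only at hw <;> subst hw
      · simp [inst, loadVal, currentVal]
      · simp [inst, loadVal, currentVal, hq]

/-- In a good state, the expectation of a cost that is bounded by the budget in good states is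
bounded by the budget. -/
lemma CompatibleEnv.lintegral_shielded_le (hwf : spec.WellFormed) (hob : spec.Obligations)
    (env : CompatibleEnv spec S A) (hA : ∀ w, spec.Assum env.interp w)
    {tail : TailFun Sg} (htail : spec.IsInvCCDF tail)
    {fallback : (Sg.Param → ℝ) → (Sg.StateVar → ℝ) → spec.ctrl.Act}
    (hfallback : spec.IsFallback env.c fallback)
    {M : MDP (ShState spec S) (ShAction spec A)} (hM : env.IsShieldedMDP tail fallback M)
    {k : ShState spec S → ℝ≥0∞} (hk : Measurable k) (hk₁ : ∀ x, k x ≤ 1)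
    (hkgood : ∀ x, env.GoodState x → k x ≤ ENNReal.ofReal (x.2.2.2 : ℝ))
    {x : ShState spec S} (hx : env.GoodState x) (a : ShAction spec A) :
    ∫⁻ y, k y ∂M.P (x, a) ≤ ENNReal.ofReal (x.2.2.2 : ℝ) := by
  classical
  have hprob := fun i => env.μ_prob (x.2.1.get i).1
  set ρ : Measure (Fin x.2.1.length → Sg.ObsVar → ℝ) :=
    Measure.pi fun i : Fin x.2.1.length => env.μ (x.2.1.get i).1 with hρ
  set B := spec.infer.sem spec.dir a.2 with hB
  set bGo : (Fin x.2.1.length → Sg.ObsVar → ℝ) → spec.GParam → ℝ := fun o p =>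
    (env.inferResult tail x a.2 o).1.total (.param p.1, none) with hbGo
  set bLo : (Fin x.2.1.length → Sg.ObsVar → ℝ) → spec.LParam → ℝ := fun o p =>
    (env.inferResult tail x a.2 o).1.total (.param p.1, none) with hbLo
  set h' : (Fin x.2.1.length → Sg.ObsVar → ℝ) → Hist spec S := fun o =>
    clearHist spec x.2.1 (mentionedObs B) ++ [(x.1, env.α x.1, bLo o)] with hh'
  set ν : (Fin x.2.1.length → Sg.ObsVar → ℝ) → Measure (ShState spec S) := fun o =>
    (env.mdp.P (x.1, env.filterAction fallback x.1 a.1 (spec.joinParams (bGo o) (bLo o)))).map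
      fun s' => (s', h' o, bGo o, (env.inferResult tail x a.2 o).2) with hν
  have hPeq : M.P (x, a) = ρ.bind ν := hM.P_eq x a
  -- Otherwise the bind would be the zero measure, whereas the transition law is a probability
  -- measure.
  have hνm : AEMeasurable ν ρ := by
    by_contra hne
    have h0 : M.P (x, a) = 0 := by
      rw [hPeq, Measure.bind, Measure.map_of_not_aemeasurable hne, Measure.join_zero]
    exact IsProbabilityMeasure.ne_zero (M.P (x, a)) h0
  have hgint : ∀ o, ∫⁻ y, k y ∂ν o = ∫⁻ s', k (s', h' o, bGo o, (env.inferResult tail x a.2 o).2)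
      ∂(env.mdp.P (x.1,
        env.filterAction fallback x.1 a.1 (spec.joinParams (bGo o) (bLo o)))) := fun o =>
    lintegral_map hk (by fun_prop)
  rw [hPeq, Measure.lintegral_bind hνm hk.aemeasurable]
  have hgm : AEMeasurable (fun o => ∫⁻ y, k y ∂ν o) ρ :=
    (Measure.measurable_lintegral hk).comp_aemeasurable hνm
  have hg₁ : ∀ o, ∫⁻ y, k y ∂ν o ≤ 1 := fun o => by
    rw [hgint]
    exact (lintegral_mono fun _ => hk₁ _).trans (by simp)
  choose bH hbH using fun i : Fin x.2.1.length => hx.hist _ (List.get_mem x.2.1 i)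
  -- Only the state component of each point is kept; parameters are set to 0 because noise laws read
  -- state variables only.
  set W : Option ℕ → DLVar Sg → ℝ := fun i =>
    (currentPt (histPt x.2.1 bH) (x.2.1.length + 1) x.1 0 i).elim 0
      fun q => join (env.φs q.1) 0 with hW
  have hWpt : ∀ b i q, currentPt (histPt x.2.1 bH) (x.2.1.length + 1) x.1 b i = some q →
      ∀ z, W i (.state z) = env.φs q.1 z := by
    rintro b (_ | i) q hq z
    · obtain rfl := Option.some.inj hq
      rfl
    · simp only [currentPt] at hq
      by_cases hi : i = x.2.1.length + 1
      · rw [if_pos hi] at hq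
        obtain rfl := Option.some.inj hq
        simp [hW, currentPt, hi, join]
      · rw [if_neg hi] at hq
        simp [hW, currentPt, hi, hq, join]
  have hWk : ∀ i : Fin x.2.1.length, W (some (i + 1)) = join (env.φs (x.2.1.get i).1) 0 := by
    intro i
    have hi := i.2.ne
    simp [hW, currentPt, histPt, hi, Nat.succ_le_iff]
  obtain ⟨hmeas, hmap⟩ := env.aemeasurable_measurement_and_map x.2.1 W hWk
  obtain ⟨E, rem', hE, hrem, hinv⟩ := exists_event_foldl_stepAssign (φs := env.φs) hwf hob hA hWpt
    B (soundInst_of_mem_sem hwf hob hA htail W a.2) x.2.2.2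
  have hrem' : ∀ o, (env.inferResult tail x a.2 o).2 = rem' := fun o => hrem _
  -- Off `E` inference is sound, so the next state is almost surely good with budget `rem'`.
  have hgood : ∀ η ∉ E, ∫⁻ y, k y ∂ν (env.measurement x.2.1 η) ≤ ENNReal.ofReal (rem' : ℝ) := by
    intro η hη
    set o := env.measurement x.2.1 η with ho
    have hI : InferInv spec env.interp env.φs (histPt x.2.1 bH) (x.2.1.length + 1) x.1 η
        (env.inferResult tail x a.2 o).1 :=
      hinv η hη _ (env.inferInv_loadVal hx hbH _ η)
    obtain ⟨hbd, hiv⟩ := hI.bound_and_inv (env.inferResult_isSome hwf tail x a.2 o)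
    have hjoin : spec.joinParams (bGo o) (bLo o)
        = fun p => (env.inferResult tail x a.2 o).1.total (.param p, none) :=
      joinParams_restrict (spec := spec) fun p =>
        (env.inferResult tail x a.2 o).1.total (.param p, none)
    rw [← hjoin] at hbd hiv
    rw [hgint]
    calc _ ≤ ∫⁻ _, ENNReal.ofReal (rem' : ℝ) ∂(env.mdp.P (x.1,
        env.filterAction fallback x.1 a.1 (spec.joinParams (bGo o) (bLo o)))) := by
          refine lintegral_mono_ae ?_
          filter_upwards [env.ae_inv_filterAction hwf hob hA hfallback x.1 a.1 _ hbd hiv]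
            with s' hs'
          rw [← hrem' o]
          refine hkgood _ ⟨fun p hp => ?_, ?_, ?_⟩
          -- A global bound has no free state variable, so it carries over from the old state to the
          -- new one.
          · refine (hp env.interp _ _ ?_).1 (hbd p)
            rintro _ rfl
            simp [join, joinParams_of_isGlobal hp]
          · refine join_congr hwf.inv_free (fun p hp => ?_) hs'
            rw [joinParams_of_isGlobal hp, joinParams_of_isGlobal hp]
          · intro e he
            rcases List.mem_append.1 he with he | he
            · obtain ⟨i, hi, rfl⟩ := List.mem_mapIdx.1 he
              have := hx.hist _ (List.getElem_mem hi)
              split_ifs <;> exact this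
            · obtain rfl := List.mem_singleton.1 he
              exact ⟨bGo o, hbd, hiv⟩
      _ = ENNReal.ofReal (rem' : ℝ) := by simp
  -- `E` lives on the noise space and need not be measurable. `T` is its replacement on the
  -- observation space, null-measurable and with preimage inside `E`.
  set T := {o | ENNReal.ofReal (rem' : ℝ) < ∫⁻ y, k y ∂ν o} with hT
  have hTm : NullMeasurableSet T ρ := nullMeasurableSet_lt aemeasurable_const hgm
  have hTE : ρ T ≤ spec.stateNoiseLaw env.c W E := by
    have hmapρ : (spec.stateNoiseLaw env.c W).map (env.measurement x.2.1) = ρ := hmap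
    rw [← hmapρ] at hTm ⊢
    rw [Measure.map_apply₀ hmeas hTm]
    refine measure_mono fun η hη => ?_
    by_contra hηE
    exact (hgood η hηE).not_gt hη
  -- The inner cost is at most 1 on `T` and at most `rem'` off `T`.
  calc ∫⁻ o, ∫⁻ y, k y ∂ν o ∂ρ
      ≤ ∫⁻ o, (T.indicator 1 o + ENNReal.ofReal (rem' : ℝ)) ∂ρ := by
        refine lintegral_mono fun o => ?_
        by_cases ho : o ∈ T
        · simpa [ho] using (hg₁ o).trans le_self_add
        · simpa [ho] using not_lt.1 ho
    _ = ρ T + ENNReal.ofReal (rem' : ℝ) := by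
        rw [lintegral_add_right _ measurable_const, lintegral_indicator_one₀ hTm]
        simp [hρ]
    _ ≤ ENNReal.ofReal (x.2.2.2 : ℝ) := (add_le_add_left hTE _).trans hE

end OneStep

/-! ## Traces -/

section Traces

variable {S A : Type*} [MeasurableSpace S] [MeasurableSpace A]

/-- Extension of a trajectory by one point. -/
def extendTraj {Z : Type*} (n : ℕ) (z : Finset.Iic n → Z) (y : Z) : Finset.Iic (n + 1) → Z :=
  fun i => if h : i.1 ≤ n then z ⟨i.1, Finset.mem_Iic.2 h⟩ else y

lemma measurable_extendTraj {Z : Type*} [MeasurableSpace Z] (n : ℕ) (z : Finset.Iic n → Z) :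
    Measurable (extendTraj n z) := by
  refine measurable_pi_lambda _ fun i => ?_
  by_cases h : i.1 ≤ n
  · simp only [extendTraj, h, dite_true]; fun_prop
  · simp only [extendTraj, h, dite_false]; fun_prop

/-- The Markov decomposition at the next step, with the extended prefix made explicit for the
backward induction. -/
lemma traj_apply_eq_lintegral_succ {Z : Type*} [MeasurableSpace Z]
    (κ : (n : ℕ) → Kernel (Finset.Iic n → Z) Z) [∀ n, IsMarkovKernel (κ n)] (n : ℕ)
    (z : Finset.Iic n → Z) {U : Set (ℕ → Z)} (hU : MeasurableSet U) :
    Kernel.traj (X := fun _ => Z) κ n z U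
      = ∫⁻ y, Kernel.traj (X := fun _ => Z) κ (n + 1) (extendTraj n z y) U ∂κ n z := by
  have hm : Measurable fun w => Kernel.traj (X := fun _ => Z) κ (n + 1) w U :=
    Kernel.measurable_coe _ hU
  have hpt : Kernel.partialTraj (X := fun _ => Z) κ n (n + 1) z
      = (κ n z).map (extendTraj n z) := by
    have hI : Measurable (IicProdIoc (X := fun _ => Z) n (n + 1)) := measurable_IicProdIoc
    have hIz : Measurable (IicProdIoc (X := fun _ => Z) n (n + 1) ∘ Prod.mk z) :=
      hI.comp measurable_prodMk_left
    rw [Kernel.partialTraj_succ_self, Kernel.map_apply _ hI, Kernel.prod_apply,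
      Kernel.id_apply, Kernel.map_apply _ (by fun_prop), Measure.dirac_prod,
      Measure.map_map hI measurable_prodMk_left,
      Measure.map_map hIz (by fun_prop)]
    congr 1
    funext y i
    simp [IicProdIoc, extendTraj, MeasurableEquiv.piSingleton]
  rw [← Kernel.traj_comp_partialTraj n.le_succ, Kernel.comp_apply' _ _ _ hU, hpt,
    lintegral_map hm (measurable_extendTraj n z)]

lemma MDP.lintegral_stepKernel (M : MDP S A) (π : Policy S A) (n : ℕ) (z : Finset.Iic n → S × A)
    {f : S × A → ℝ≥0∞} (hf : Measurable f) :
    ∫⁻ y, f y ∂M.stepKernel π n z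
      = ∫⁻ x, ∫⁻ a, f (x, a) ∂π.next n (z, x) ∂M.P (z ⟨n, Finset.mem_Iic.2 le_rfl⟩) := by
  rw [MDP.stepKernel, Kernel.lintegral_compProd _ _ _ hf, Kernel.comap_apply]

lemma measurable_lintegral_next (π : Policy S A) (n : ℕ) (z : Finset.Iic n → S × A)
    {f : S × A → ℝ≥0∞} (hf : Measurable f) :
    Measurable fun x => ∫⁻ a, f (x, a) ∂π.next n (z, x) :=
  hf.lintegral_kernel_prod_right' (κ := (π.next n).comap (Prod.mk z) measurable_prodMk_left)

end Traces

/-! ## Safety -/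

section Safety

variable {Sg : Signature} {spec : ShieldSpec Sg} {S A : Type*} [MeasurableSpace S]
  [MeasurableSpace A]

lemma CompatibleEnv.GoodState.safeState (hwf : spec.WellFormed) (hob : spec.Obligations)
    {env : CompatibleEnv spec S A} (hA : ∀ w, spec.Assum env.interp w) {x : ShState spec S}
    (hx : env.GoodState x) : env.SafeState x.1 := by
  refine (hwf.safe_free _ _ _ ?_).1 (hob.inv_safe env.interp _ (hA _) hx.gbound hx.inv)
  rintro _ ⟨y, rfl⟩
  rfl

/-- The traces that violate the safety constraint up to time `N`. -/
def CompatibleEnv.violatedBy (env : CompatibleEnv spec S A) (N : ℕ) :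
    Set (ℕ → ShState spec S × ShAction spec A) :=
  {τ | ∃ t ≤ N, ¬ env.SafeState (τ t).1.1}

lemma CompatibleEnv.measurableSet_violatedBy (env : CompatibleEnv spec S A)
    (hsafe : MeasurableSet {s : S | env.SafeState s}) (N : ℕ) :
    MeasurableSet (env.violatedBy N) := by
  have : env.violatedBy N = ⋃ t ≤ N, (fun τ : ℕ → ShState spec S × ShAction spec A =>
      (τ t).1.1) ⁻¹' {s : S | env.SafeState s}ᶜ := by
    ext τ
    simp [CompatibleEnv.violatedBy]
  rw [this]
  exact MeasurableSet.iUnion fun t => MeasurableSet.iUnion fun _ =>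
    (measurable_fst.comp (measurable_fst.comp (measurable_pi_apply t))) hsafe.compl

/-- Backward induction on the number `d` of steps left until the horizon `N`. The prefix is kept
general because policies depend on the whole history. -/
lemma CompatibleEnv.traj_violatedBy_le (hwf : spec.WellFormed) (hob : spec.Obligations)
    (env : CompatibleEnv spec S A) (hA : ∀ w, spec.Assum env.interp w)
    {tail : TailFun Sg} (htail : spec.IsInvCCDF tail)
    {fallback : (Sg.Param → ℝ) → (Sg.StateVar → ℝ) → spec.ctrl.Act}
    (hfallback : spec.IsFallback env.c fallback)
    {M : MDP (ShState spec S) (ShAction spec A)} (hM : env.IsShieldedMDP tail fallback M)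
    (hsafe : MeasurableSet {s : S | env.SafeState s})
    (π : Policy (ShState spec S) (ShAction spec A)) (N d n : ℕ) (hd : N ≤ n + d)
    (z : Finset.Iic n → ShState spec S × ShAction spec A) (hz : ∀ i, env.SafeState (z i).1.1)
    (hgood : env.GoodState (z ⟨n, Finset.mem_Iic.2 le_rfl⟩).1) :
    Kernel.traj (X := fun _ => ShState spec S × ShAction spec A) (M.stepKernel π) n z
      (env.violatedBy N) ≤ ENNReal.ofReal ((z ⟨n, Finset.mem_Iic.2 le_rfl⟩).1.2.2.2 : ℝ) := by
  have hU := env.measurableSet_violatedBy hsafe N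
  induction d generalizing n with
  | zero =>
    refine le_of_eq_of_le ?_ zero_le
    -- All times up to `N` lie in the prefix `z`, which the trajectory law preserves and which is
    -- safe.
    rw [← Kernel.traj_map_updateFinset, Measure.map_apply measurable_updateFinset_left hU]
    have hempty : (fun τ => Function.updateFinset τ (Finset.Iic n) z) ⁻¹' env.violatedBy N = ∅ := by
      ext τ
      simp only [Set.mem_preimage, CompatibleEnv.violatedBy, Set.mem_ofPred_eq, Set.mem_empty_iff_false,
        iff_false, not_exists, not_and, not_not]
      intro t ht
      have htn : t ∈ Finset.Iic n := Finset.mem_Iic.2 (by omega)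
      simp only [Function.updateFinset, htn, dite_true]
      exact hz _
    rw [hempty, measure_empty]
  | succ d ih =>
    rw [traj_apply_eq_lintegral_succ _ _ _ hU]
    have hf : Measurable fun y => Kernel.traj (X := fun _ => ShState spec S × ShAction spec A)
        (M.stepKernel π) (n + 1) (extendTraj n z y) (env.violatedBy N) :=
      (Kernel.measurable_coe _ hU).comp (measurable_extendTraj n z)
    rw [M.lintegral_stepKernel π n z hf]
    -- The cost of a next state is its violation probability averaged over the policy's next action;
    -- the induction hypothesis bounds it by the budget in good states.
    refine env.lintegral_shielded_le hwf hob hA htail hfallback hM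
      (measurable_lintegral_next π n z hf) (fun x => ?_) (fun x hx => ?_) hgood
      (z ⟨n, Finset.mem_Iic.2 le_rfl⟩).2
    · exact (lintegral_mono fun a => prob_le_one).trans (by simp)
    · refine (lintegral_mono (g := fun _ => ENNReal.ofReal (x.2.2.2 : ℝ)) fun a => ?_).trans
        (by simp)
      have hlast : extendTraj n z (x, a) ⟨n + 1, Finset.mem_Iic.2 le_rfl⟩ = (x, a) := by
        simp [extendTraj]
      have := ih (n + 1) (by omega) (extendTraj n z (x, a)) (fun i => ?_) (by rwa [hlast])
      · rwa [hlast] at this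
      · unfold extendTraj
        split_ifs
        · exact hz _
        · exact hx.safeState hwf hob hA

lemma CompatibleEnv.traceLaw_violatedBy_le (hwf : spec.WellFormed) (hob : spec.Obligations)
    (env : CompatibleEnv spec S A) (hA : ∀ w, spec.Assum env.interp w)
    {tail : TailFun Sg} (htail : spec.IsInvCCDF tail)
    {fallback : (Sg.Param → ℝ) → (Sg.StateVar → ℝ) → spec.ctrl.Act}
    (hfallback : spec.IsFallback env.c fallback)
    {M : MDP (ShState spec S) (ShAction spec A)} (hM : env.IsShieldedMDP tail fallback M)
    (hsafe : MeasurableSet {s : S | env.SafeState s})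
    (π : Policy (ShState spec S) (ShAction spec A)) {x : ShState spec S} (hx : env.GoodState x)
    (N : ℕ) : M.traceLaw π x (env.violatedBy N) ≤ ENNReal.ofReal (x.2.2.2 : ℝ) := by
  have hU := env.measurableSet_violatedBy hsafe N
  have hm : Measurable fun w => Kernel.traj (X := fun _ => ShState spec S × ShAction spec A)
      (M.stepKernel π) 0 w (env.violatedBy N) := Kernel.measurable_coe _ hU
  have hm' : Measurable fun y => Kernel.traj (X := fun _ => ShState spec S × ShAction spec A)
      (M.stepKernel π) 0 ((MeasurableEquiv.piUnique
        fun _ : Finset.Iic 0 => ShState spec S × ShAction spec A).symm y) (env.violatedBy N) :=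
    hm.comp (MeasurableEquiv.measurable _)
  rw [MDP.traceLaw, Kernel.trajMeasure, Measure.bind_apply hU (Kernel.aemeasurable _),
    lintegral_map hm (by fun_prop), Measure.lintegral_compProd hm',
    lintegral_dirac' _ hm'.lintegral_kernel_prod_right']
  refine (lintegral_mono (g := fun _ => ENNReal.ofReal (x.2.2.2 : ℝ)) fun a => ?_).trans
    (by simp)
  -- The prefix is the single initial state-action pair, with `N` steps left.
  refine env.traj_violatedBy_le hwf hob hA htail hfallback hM hsafe π N N 0 (by omega)
    ((MeasurableEquiv.piUnique fun _ : Finset.Iic 0 => ShState spec S × ShAction spec A).symm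
      (x, a)) (fun i => ?_) hx
  obtain rfl : i = default := Subsingleton.elim _ _
  exact hx.safeState hwf hob hA

end Safety

end AdaptiveShield

end

theorem mainTheorem1 {Sg : AdaptiveShield.Signature} (spec : AdaptiveShield.ShieldSpec Sg)
    (hwf : spec.WellFormed) (hob : spec.Obligations)
    {S A : Type*} [MeasurableSpace S] [MeasurableSpace A]
    (env : AdaptiveShield.CompatibleEnv spec S A)
    (tail : AdaptiveShield.TailFun Sg) (htail : spec.IsInvCCDF tail)
    (fallback : (Sg.Param → ℝ) → (Sg.StateVar → ℝ) → spec.ctrl.Act)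
    (hfallback : spec.IsFallback env.c fallback)
    (M : AdaptiveShield.MDP (AdaptiveShield.ShState spec S) (AdaptiveShield.ShAction spec A))
    (hM : env.IsShieldedMDP tail fallback M)
    (hsafe : MeasurableSet {s : S | env.SafeState s})
    (ε : unitInterval) (b : spec.GParam → ℝ) (s : S)
    (hassum : spec.Assum ⟨env.c, env.u⟩ (AdaptiveShield.join (env.φs s) (spec.joinParams b 0)))
    (hbound : spec.GBound ⟨env.c, env.u⟩ (AdaptiveShield.join (env.φs s) (spec.joinParams b 0)))
    (hinv : spec.inv.sem ⟨env.c, env.u⟩ (AdaptiveShield.join (env.φs s) (spec.joinParams b 0)))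
    (π : AdaptiveShield.Policy (AdaptiveShield.ShState spec S) (AdaptiveShield.ShAction spec A)) :
    ENNReal.ofReal (1 - (ε : ℝ)) ≤
      M.traceLaw π (s, [], b, ε) {τ | ∀ t : ℕ, env.SafeState (τ t).1.1} := by
  -- Assumptions are closed formulas: true in one state, they are true in all.
  have hA : ∀ w, spec.Assum env.interp w := fun w P hP =>
    (hwf.assum_closed P hP _ _ w fun _ hx => hx.elim).1 (hassum P hP)
  have hx : env.GoodState (s, [], b, ε) := ⟨hbound, hinv, fun _ he => absurd he List.not_mem_nil⟩
  have hμ : IsProbabilityMeasure (M.traceLaw π (s, [], b, ε)) := by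
    unfold AdaptiveShield.MDP.traceLaw; infer_instance
  have hviol : M.traceLaw π (s, [], b, ε) (⋃ N, env.violatedBy N) ≤ ENNReal.ofReal (ε : ℝ) := by
    have hmono : Monotone env.violatedBy := fun N N' hN τ ⟨t, ht, h⟩ => ⟨t, ht.trans hN, h⟩
    -- The events increase with `N`, so the bound, uniform in `N`, passes to their union.
    rw [hmono.measure_iUnion]
    exact iSup_le fun N => env.traceLaw_violatedBy_le hwf hob hA htail hfallback hM hsafe π hx N
  have hset : {τ : ℕ → AdaptiveShield.ShState spec S × AdaptiveShield.ShAction spec A |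
      ∀ t : ℕ, env.SafeState (τ t).1.1} = (⋃ N, env.violatedBy N)ᶜ := by
    ext τ
    simp only [AdaptiveShield.CompatibleEnv.violatedBy, Set.mem_ofPred_eq, Set.mem_compl_iff,
      Set.mem_iUnion, not_exists, not_and, not_not]
    exact ⟨fun h N t _ => h t, fun h t => h t t le_rfl⟩
  rw [hset, prob_compl_eq_one_sub (MeasurableSet.iUnion fun N => env.measurableSet_violatedBy hsafe N),
    ENNReal.ofReal_sub _ ε.2.1, ENNReal.ofReal_one]
  exact tsub_le_tsub_left hviol 1
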